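/- Let $n\ge 2$, $S^1=\mathbb R/2\pi\mathbb Z$, and let $$\mathcal M_n(S^1)=\{\gamma\in C^\infty(S^1,\mathbb R^n)\ :\ \det(\gamma,\gamma_x,\dots,\gamma_x^{(n-1)})=1\}.$$ For $\gamma\in\mathcal M_n(S^1)$ let $g=(\gamma,\gamma_x,\dots,\gamma_x^{(n-1)})$, let $b=\sum_{i=1}^{n-1}e_{i+1,i}$, and let $u=\Psi(\gamma)=\sum_{i=1}^{n-1}u_ie_{in}\in C^\infty(S^1,V_n)$, $V_n=\bigoplus_{i=1}^{n-1}\mathbb R e_{in}$, be the central affine curvature, where $u_i=\det(\gamma,\dots,\gamma_x^{(i-2)},\gamma_x^{(n)},\gamma_x^{(i)},\dots,\gamma_x^{(n-1)})$; thus $g_x=g(b+u)$. The tangent space $T_\gamma\mathcal M_n(S^1)$ consists of the $X\in C^\infty(S^1,\mathbb R^n)$ with $\sum_{i=0}^{n-1}\det(\gamma,\dots,\gamma_x^{(i-1)},X_x^{(i)},\gamma_x^{(i+1)},\dots,\gamma_x^{(n-1)})=0$; for such $X$ put $\delta_Xg=(X,X_x,\dots,X_x^{(n-1)})$. Let $\langle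 A,B\rangle=\oint\operatorname{tr}(AB)\,dx$, $[\partial_x+b+u,C]=C_x+[b+u,C]$, and $$(\hat w_2)_\gamma(X,Y)=\big\langle[\partial_x+b+u,\,g^{-1}\delta_Xg],\ g^{-1}\delta_Yg\big\rangle ,\qquad X,Y\in T_\gamma\mathcal M_n(S^1).$$ The group $SL(n,\mathbb R)$ acts on $\mathcal M_n(S^1)$ by $(c\gamma)(x)=c\,\gamma(x)$; let $q$ be the projection to the orbit space $\mathcal M_n(S^1)/SL(n,\mathbb R)$, whose tangent space at $q(\gamma)$ is $T_\gamma\mathcal M_n(S^1)/T_\gamma(SL(n,\mathbb R)\gamma)$ (the action is free). Smoothness and closedness of forms are tested on smooth finite-dimensional families. Then the following hold. 1. $\hat w_2$ is the 2-form defined by the pull-back by $\Psi$ of the second Poisson structure $$\{F_1,F_2\}_2(u)=\langle[\partial_x+b+u,P_u(\nabla F_1(u))],P_u(\nabla F_2(u))\rangle$$ on $C^\infty(S^1,V_n)$. Here the gradient $\nabla F(u)$ with respect to $\langle\,,\rangle$ takes values in $V_n^t=\bigoplus_{i=1}^{n-1}\mathbb R e_{ni}$, and $P_u(v)$ is the $sl(n,\mathbb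 R)$-valued $C$ with $C_{ni}=v_{ni}$ for $1\le i\le n-1$ and $[\partial_x+b+u,C]\in C^\infty(S^1,V_n)$. That is, with $u=\Psi(\gamma)$: if $d\Psi_\gamma(X_i)=[\partial_x+b+u,P_u(\nabla F_i(u))]$ for $i=1,2$, then $(\hat w_2)_\gamma(X_1,X_2)=\{F_1,F_2\}_2(u)$; and every $X\in T_\gamma\mathcal M_n(S^1)$ satisfies such an equation for some functional $F$. 2. $\hat w_2$ is a smooth closed 2-form on $\mathcal M_n(S^1)$. 3. For each $\gamma$, the kernel $\{X:(\hat w_2)_\gamma(X,Y)=0\text{ for all }Y\}$ is the tangent space $\{c_0\gamma: c_0\in sl(n,\mathbb R)\}$ of the $SL(n,\mathbb R)$-orbit at $\gamma$, and this is also the kernel of $d\Psi_\gamma$. 4. $\hat w_2$ induces a weak symplectic form on $\mathcal M_n(S^1)/SL(n,\mathbb R)$: there is exactly one form $\Omega$ on the orbit space with $q^*\Omega=\hat w_2$, and $\Omega$ is a smooth closed 2-form such that $\Omega_p(\xi,\eta)=0$ for all $\eta$ implies $\xi=0$. -/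

import Mathlib

open scoped ContDiff

namespace CentralAffine

/-! ### Smooth loops

The circle is `ℝ / 2πℤ`; maps on it are `2π`-periodic maps on `ℝ`, and `∮` is the integral over
`[0, 2π]`. -/

/-- `f` is (the lift to `ℝ` of) a smooth map from the circle to `E`. -/
structure IsSmoothLoop {E : Type} [NormedAddCommGroup E] [NormedSpace ℝ E] (f : ℝ → E) : Prop where
  contDiff : ContDiff ℝ ∞ f
  periodic : Function.Periodic f (2 * Real.pi)

theorem IsSmoothLoop.add {E : Type} [NormedAddCommGroup E] [NormedSpace ℝ E] {f g : ℝ → E}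
    (hf : IsSmoothLoop f) (hg : IsSmoothLoop g) : IsSmoothLoop (f + g) :=
  ⟨hf.1.add hg.1, fun x => by simp only [Pi.add_apply, hf.2 x, hg.2 x]⟩

theorem IsSmoothLoop.smul {E : Type} [NormedAddCommGroup E] [NormedSpace ℝ E] {f : ℝ → E}
    (a : ℝ) (hf : IsSmoothLoop f) : IsSmoothLoop (a • f) :=
  ⟨hf.1.const_smul a, fun x => by simp only [Pi.smul_apply, hf.2 x]⟩

theorem IsSmoothLoop.zero {E : Type} [NormedAddCommGroup E] [NormedSpace ℝ E] :
    IsSmoothLoop (0 : ℝ → E) :=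
  ⟨contDiff_const, fun _ => rfl⟩

theorem IsSmoothLoop.iteratedDeriv {E : Type} [NormedAddCommGroup E] [NormedSpace ℝ E] {f : ℝ → E}
    (hf : IsSmoothLoop f) (k : ℕ) : IsSmoothLoop (iteratedDeriv k f) := by
  induction k with
  | zero => simpa using hf
  | succ k ih =>
    rw [iteratedDeriv_succ]
    refine ⟨(contDiff_infty_iff_deriv.mp ih.1).2, fun x => ?_⟩
    rw [← deriv_comp_add_const]
    congr 1
    exact funext ih.2

/-- The space `C^∞(S¹, W)` of smooth loops in a linear space `W` of matrices. -/
def loopsIn {n : ℕ} (W : Submodule ℝ (Matrix (Fin n) (Fin n) ℝ)) :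
    Submodule ℝ (ℝ → Matrix (Fin n) (Fin n) ℝ) where
  carrier := {A | (∀ i j, IsSmoothLoop fun x => A x i j) ∧ ∀ x, A x ∈ W}
  add_mem' hA hB := ⟨fun i j => (hA.1 i j).add (hB.1 i j), fun x => W.add_mem (hA.2 x) (hB.2 x)⟩
  zero_mem' := ⟨fun _ _ => IsSmoothLoop.zero, fun _ => W.zero_mem⟩
  smul_mem' a _ hA := ⟨fun i j => (hA.1 i j).smul a, fun x => W.smul_mem a (hA.2 x)⟩

/-- `sl(n, ℝ)`. -/
def slSpace (n : ℕ) : Submodule ℝ (Matrix (Fin n) (Fin n) ℝ) :=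
  LinearMap.ker (Matrix.traceLinearMap (Fin n) ℝ ℝ)

/-- `V_n = ⊕_{i=1}^{n-1} ℝ e_{in}` (indices start at `0` in the code). -/
def VSpace (n : ℕ) : Submodule ℝ (Matrix (Fin n) (Fin n) ℝ) where
  carrier := {A | ∀ i j : Fin n, ¬ ((i : ℕ) + 1 < n ∧ (j : ℕ) + 1 = n) → A i j = 0}
  add_mem' hA hB i j h := by simp [hA i j h, hB i j h]
  zero_mem' _ _ _ := rfl
  smul_mem' a A hA i j h := by simp [hA i j h]

/-- `V_n^t = ⊕_{i=1}^{n-1} ℝ e_{ni}`. -/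
def VtSpace (n : ℕ) : Submodule ℝ (Matrix (Fin n) (Fin n) ℝ) where
  carrier := {A | ∀ i j : Fin n, ¬ ((i : ℕ) + 1 = n ∧ (j : ℕ) + 1 < n) → A i j = 0}
  add_mem' hA hB i j h := by simp [hA i j h, hB i j h]
  zero_mem' _ _ _ := rfl
  smul_mem' a A hA i j h := by simp [hA i j h]

/-! ### Curves, moving frame, curvature -/

/-- The matrix `(γ, γ_x, …, γ_x^{(n-1)})` (columns) at `x`. -/
noncomputable def frame {n : ℕ} (γ : ℝ → Fin n → ℝ) (x : ℝ) : Matrix (Fin n) (Fin n) ℝ :=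
  Matrix.of fun i j => iteratedDeriv (j : ℕ) γ x i

/-- `M_n(S¹)`: smooth loops `γ` in `ℝⁿ` with `det (γ, γ_x, …, γ_x^{(n-1)}) = 1`.
For `n ≥ 1` such a loop avoids the origin automatically. -/
@[ext]
structure Curve (n : ℕ) where
  toFun : ℝ → Fin n → ℝ
  smooth : IsSmoothLoop toFun
  det_frame : ∀ x, (frame toFun x).det = 1

/-- The central affine curvature matrix `∑_{i=1}^{n-1} u_i e_{in}` of `γ` at `x`, where
`u_i = det (γ, …, γ_x^{(i-2)}, γ_x^{(n)}, γ_x^{(i)}, …, γ_x^{(n-1)})`. -/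
noncomputable def curvMatrix {n : ℕ} (γ : ℝ → Fin n → ℝ) (x : ℝ) : Matrix (Fin n) (Fin n) ℝ :=
  Matrix.of fun i j =>
    if (i : ℕ) + 1 < n ∧ (j : ℕ) + 1 = n then
      ((frame γ x).updateCol i (iteratedDeriv n γ x)).det
    else 0

theorem isSmoothLoop_apply {n : ℕ} {f : ℝ → Fin n → ℝ} (hf : IsSmoothLoop f) (i : Fin n) :
    IsSmoothLoop fun x => f x i :=
  ⟨contDiff_pi.mp hf.1 i, fun x => by simp only [hf.2 x]⟩

theorem isSmoothLoop_det {n : ℕ} {A : ℝ → Matrix (Fin n) (Fin n) ℝ}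
    (hA : ∀ i j, IsSmoothLoop fun x => A x i j) : IsSmoothLoop fun x => (A x).det := by
  refine ⟨?_, fun x => ?_⟩
  · simp only [Matrix.det_apply]
    refine ContDiff.sum fun σ _ => ContDiff.const_smul _ ?_
    exact contDiff_prod fun i _ => (hA (σ i) i).1
  · have : A (x + 2 * Real.pi) = A x := by ext i j; exact (hA i j).2 x
    simp only [this]

theorem curvMatrix_mem {n : ℕ} {γ : ℝ → Fin n → ℝ} (hγ : IsSmoothLoop γ) :
    curvMatrix γ ∈ loopsIn (VSpace n) := by
  refine ⟨fun i j => ?_, fun x i j h => by simp [curvMatrix, h]⟩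
  by_cases h : (i : ℕ) + 1 < n ∧ (j : ℕ) + 1 = n
  · simp only [curvMatrix, Matrix.of_apply, h, and_self, if_true]
    refine isSmoothLoop_det fun k l => ?_
    simp only [Matrix.updateCol_apply, frame, Matrix.of_apply]
    split_ifs
    · exact isSmoothLoop_apply (hγ.iteratedDeriv _) k
    · exact isSmoothLoop_apply (hγ.iteratedDeriv _) k
  · simp only [curvMatrix, Matrix.of_apply, h, if_false]
    exact IsSmoothLoop.zero

/-- The central affine curvature map `Ψ : M_n(S¹) → C^∞(S¹, V_n)`. -/
noncomputable def curvature {n : ℕ} (γ : Curve n) : loopsIn (VSpace n) :=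
  ⟨curvMatrix γ.toFun, curvMatrix_mem γ.smooth⟩

/-! ### Tangent vectors -/

theorem frame_add {n : ℕ} {X Y : ℝ → Fin n → ℝ} (hX : IsSmoothLoop X) (hY : IsSmoothLoop Y)
    (x : ℝ) : frame (X + Y) x = frame X x + frame Y x := by
  ext i j
  simp only [frame, Matrix.of_apply, Matrix.add_apply]
  rw [iteratedDeriv_add (hX.1.contDiffAt.of_le (by exact_mod_cast le_top))
    (hY.1.contDiffAt.of_le (by exact_mod_cast le_top))]
  rfl

theorem frame_smul {n : ℕ} (a : ℝ) (X : ℝ → Fin n → ℝ) (x : ℝ) :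
    frame (a • X) x = a • frame X x := by
  ext i j
  simp only [frame, Matrix.of_apply, Matrix.smul_apply]
  rw [iteratedDeriv_const_smul_field]
  rfl

/-- `∑_i det (γ, …, γ_x^{(i-1)}, X_x^{(i)}, γ_x^{(i+1)}, …, γ_x^{(n-1)})` at `x`. -/
noncomputable def tangencyDefect {n : ℕ} (γ X : ℝ → Fin n → ℝ) (x : ℝ) : ℝ :=
  ∑ i : Fin n, ((frame γ x).updateCol i fun k => frame X x k i).det

/-- The tangent space of `M_n(S¹)` at `γ`. -/
def Tangent {n : ℕ} (γ : Curve n) : Submodule ℝ (ℝ → Fin n → ℝ) where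
  carrier := {X | IsSmoothLoop X ∧ ∀ x, tangencyDefect γ.toFun X x = 0}
  add_mem' {X Y} hX hY := by
    refine ⟨hX.1.add hY.1, fun x => ?_⟩
    have h1 := hX.2 x
    have h2 := hY.2 x
    simp only [tangencyDefect] at h1 h2 ⊢
    rw [frame_add hX.1 hY.1]
    have : ∀ i : Fin n, (fun k => (frame X x + frame Y x) k i)
        = (fun k => frame X x k i) + fun k => frame Y x k i := fun i => rfl
    simp only [this, Matrix.det_updateCol_add, Finset.sum_add_distrib, h1, h2, add_zero]
  zero_mem' := by
    refine ⟨IsSmoothLoop.zero, fun x => ?_⟩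
    have h := frame_smul (0 : ℝ) (0 : ℝ → Fin n → ℝ) x
    simp only [zero_smul] at h
    simp only [tangencyDefect, h]
    refine Finset.sum_eq_zero fun i _ => ?_
    exact Matrix.det_eq_zero_of_column_eq_zero i fun k => by simp
  smul_mem' a X hX := by
    refine ⟨hX.1.smul a, fun x => ?_⟩
    have h1 := hX.2 x
    simp only [tangencyDefect] at h1 ⊢
    rw [frame_smul]
    have : ∀ i : Fin n, (fun k => (a • frame X x) k i) = a • fun k => frame X x k i := fun i => rfl
    simp only [this, Matrix.det_updateCol_smul, ← Finset.mul_sum, h1, mul_zero]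

/-- `g⁻¹ δg` for `g = (γ, …, γ_x^{(n-1)})` and `δg = (X, …, X_x^{(n-1)})`. -/
noncomputable def logVar {n : ℕ} (γ : Curve n) (X : Tangent γ) (x : ℝ) :
    Matrix (Fin n) (Fin n) ℝ :=
  (frame γ.toFun x)⁻¹ * frame X.1 x

/-- The differential of the curvature map at `γ`: the derivative of
`s ↦ Ψ (γ + s X)`, entry by entry, at `s = 0` (the formula for `Ψ` is polynomial in the
derivatives of the curve, and makes sense for all smooth loops). -/
noncomputable def dCurvature {n : ℕ} (γ : Curve n) (X : Tangent γ) (x : ℝ) :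
    Matrix (Fin n) (Fin n) ℝ :=
  Matrix.of fun i j => deriv (fun s : ℝ => curvMatrix (γ.toFun + s • X.1) x i j) 0

/-! ### The second Poisson structure and the 2-form -/

/-- `⟨A, B⟩ = ∮ tr (A B) dx`. -/
noncomputable def pairing {n : ℕ} (A B : ℝ → Matrix (Fin n) (Fin n) ℝ) : ℝ :=
  ∫ x in (0 : ℝ)..(2 * Real.pi), (A x * B x).trace

/-- `b = ∑_{i=1}^{n-1} e_{i+1,i}`. -/
def bMatrix (n : ℕ) : Matrix (Fin n) (Fin n) ℝ :=
  Matrix.of fun i j => if (i : ℕ) = j + 1 then 1 else 0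

/-- `[∂_x + b + u, C] = C_x + [b + u, C]`. -/
noncomputable def laxBracket {n : ℕ} (u C : ℝ → Matrix (Fin n) (Fin n) ℝ) (x : ℝ) :
    Matrix (Fin n) (Fin n) ℝ :=
  (Matrix.of fun i j => deriv (fun y => C y i j) x)
    + ((bMatrix n + u x) * C x - C x * (bMatrix n + u x))

/-- `v` is the gradient at `u` of the functional `F` on `C^∞(S¹, V_n)`. -/
def IsGradient {n : ℕ} (F : loopsIn (VSpace n) → ℝ) (u : loopsIn (VSpace n))
    (v : loopsIn (VtSpace n)) : Prop :=
  ∀ w : loopsIn (VSpace n), HasDerivAt (fun s : ℝ => F (u + s • w)) (pairing v.1 w.1) 0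

/-- `C = P_u(v)`: the loop `C` in `sl(n, ℝ)` has the last row of `v`, apart from the corner entry,
and `[∂_x + b + u, C]` takes values in `V_n`. -/
structure IsP {n : ℕ} (u : loopsIn (VSpace n)) (v : loopsIn (VtSpace n))
    (C : loopsIn (slSpace n)) : Prop where
  lastRow : ∀ (x : ℝ) (i j : Fin n), (i : ℕ) + 1 = n → (j : ℕ) + 1 < n → C.1 x i j = v.1 x i j
  bracket_mem : laxBracket u.1 C.1 ∈ loopsIn (VSpace n)

/-- `C = P_u(∇F(u))`. -/
def IsPGradient {n : ℕ} (F : loopsIn (VSpace n) → ℝ) (u : loopsIn (VSpace n))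
    (C : loopsIn (slSpace n)) : Prop :=
  ∃ v, IsGradient F u v ∧ IsP u v C

/-- `r = {F₁, F₂}₂(u) = ⟨[∂_x + b + u, P_u(∇F₁(u))], P_u(∇F₂(u))⟩`. -/
def IsPoissonBracket {n : ℕ} (F₁ F₂ : loopsIn (VSpace n) → ℝ) (u : loopsIn (VSpace n)) (r : ℝ) :
    Prop :=
  ∃ C₁ C₂ : loopsIn (slSpace n), IsPGradient F₁ u C₁ ∧ IsPGradient F₂ u C₂ ∧
    r = pairing (laxBracket u.1 C₁.1) C₂.1

/-- `X` is the value at `γ` of a Hamiltonian vector field of `F ∘ Ψ` for the pull-back by `Ψ` of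
the second Poisson structure: `dΨ_γ(X) = (J₂)_u(∇F(u)) = [∂_x + b + u, P_u(∇F(u))]`,
`u = Ψ(γ)`. -/
def IsHamiltonianAt {n : ℕ} (F : loopsIn (VSpace n) → ℝ) (γ : Curve n) (X : Tangent γ) : Prop :=
  ∃ C : loopsIn (slSpace n), IsPGradient F (curvature γ) C ∧
    dCurvature γ X = laxBracket (curvature γ).1 C.1

/-- The 2-form `ŵ₂` on `M_n(S¹)`:
`ŵ₂(X, Y) = ⟨[∂_x + b + u, g⁻¹ δ_X g], g⁻¹ δ_Y g⟩` at `γ`. -/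
noncomputable def wTwo {n : ℕ} (γ : Curve n) (X Y : Tangent γ) : ℝ :=
  pairing (laxBracket (curvature γ).1 (logVar γ X)) (logVar γ Y)

/-! ### The action of `SL(n, ℝ)` and the orbit space -/

/-- The special linear group `SL(n, ℝ)`. -/
abbrev SLn (n : ℕ) : Type := Matrix.SpecialLinearGroup (Fin n) ℝ

theorem iteratedDeriv_mulVec {n : ℕ} (c : Matrix (Fin n) (Fin n) ℝ) {f : ℝ → Fin n → ℝ}
    (hf : IsSmoothLoop f) (k : ℕ) (x : ℝ) :
    iteratedDeriv k (fun y => c.mulVec (f y)) x = c.mulVec (iteratedDeriv k f x) := by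
  have key : ∀ y, iteratedDeriv k (fun y => c.mulVec (f y)) y = c.mulVec (iteratedDeriv k f y) := by
    induction k with
    | zero => simp
    | succ k ih =>
      intro y
      rw [iteratedDeriv_succ, iteratedDeriv_succ, funext ih]
      have hd : HasDerivAt (iteratedDeriv k f) (deriv (iteratedDeriv k f) y) y :=
        ((hf.iteratedDeriv k).1.differentiable (by simp) y).hasDerivAt
      let L : (Fin n → ℝ) →L[ℝ] (Fin n → ℝ) := LinearMap.toContinuousLinearMap c.mulVecLin
      exact (L.hasFDerivAt.comp_hasDerivAt y hd).deriv
  exact key x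

theorem frame_mulVec {n : ℕ} (c : Matrix (Fin n) (Fin n) ℝ) {f : ℝ → Fin n → ℝ}
    (hf : IsSmoothLoop f) (x : ℝ) : frame (fun y => c.mulVec (f y)) x = c * frame f x := by
  ext i j
  simp only [frame, Matrix.of_apply, iteratedDeriv_mulVec c hf]
  rfl

theorem IsSmoothLoop.mulVec {n : ℕ} (c : Matrix (Fin n) (Fin n) ℝ) {f : ℝ → Fin n → ℝ}
    (hf : IsSmoothLoop f) : IsSmoothLoop fun y => c.mulVec (f y) :=
  ⟨(LinearMap.toContinuousLinearMap c.mulVecLin).contDiff.comp hf.1,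
    fun x => by simp only [hf.2 x]⟩

/-- `SL(n, ℝ)` acts on `M_n(S¹)` by `(c γ)(x) = c (γ(x))`. -/
noncomputable instance {n : ℕ} : MulAction (SLn n) (Curve n) where
  smul c γ := ⟨fun x => c.1.mulVec (γ.toFun x), γ.smooth.mulVec c.1, fun x => by
    rw [frame_mulVec _ γ.smooth, Matrix.det_mul, γ.det_frame, c.2, mul_one]⟩
  one_smul γ := by
    ext x : 2
    exact Matrix.one_mulVec _
  mul_smul c d γ := by
    ext x : 2
    exact (Matrix.mulVec_mulVec _ c.1 d.1).symm

theorem smul_toFun {n : ℕ} (c : SLn n) (γ : Curve n) :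
    (c • γ).toFun = fun x => c.1.mulVec (γ.toFun x) := rfl

theorem frame_smul_curve {n : ℕ} (c : SLn n) (γ : Curve n) (x : ℝ) :
    frame (c • γ).toFun x = c.1 * frame γ.toFun x := frame_mulVec _ γ.smooth x

/-- The action on `M_n(S¹)` is free. -/
theorem smul_injective {n : ℕ} {c d : SLn n} {γ : Curve n} (h : c • γ = d • γ) : c = d := by
  have h1 : c.1 * frame γ.toFun 0 = d.1 * frame γ.toFun 0 := by
    rw [← frame_smul_curve, ← frame_smul_curve, h]
  have h2 : IsUnit (frame γ.toFun 0) := by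
    rw [Matrix.isUnit_iff_isUnit_det, γ.det_frame]; exact isUnit_one
  exact Subtype.ext (h2.mul_right_cancel h1)

theorem mulVec_mem_tangent {n : ℕ} (c : SLn n) (γ : Curve n) (X : Tangent γ) :
    (fun x => c.1.mulVec (X.1 x)) ∈ Tangent (c • γ) := by
  refine ⟨X.2.1.mulVec c.1, fun x => ?_⟩
  rw [← X.2.2 x]
  simp only [tangencyDefect, frame_smul_curve, frame_mulVec _ X.2.1]
  refine Finset.sum_congr rfl fun i _ => ?_
  have : (c.1 * frame γ.toFun x).updateCol i (fun k => (c.1 * frame X.1 x) k i)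
      = c.1 * (frame γ.toFun x).updateCol i (fun k => frame X.1 x k i) := by
    ext k l
    simp only [Matrix.updateCol_apply, Matrix.mul_apply]
    split_ifs with h
    · rfl
    · rfl
  rw [this, Matrix.det_mul, c.2, one_mul]

/-- The tangent space at `γ` of the orbit `SL(n, ℝ) · γ`: the values `c₀ γ`, `c₀ ∈ sl(n, ℝ)`, of the
infinitesimal action. -/
def orbitTangent {n : ℕ} (γ : Curve n) : Submodule ℝ (Tangent γ) where
  carrier := {X | ∃ c₀ ∈ slSpace n, ∀ x, X.1 x = c₀.mulVec (γ.toFun x)}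
  add_mem' := by
    rintro X Y ⟨c, hc, hX⟩ ⟨d, hd, hY⟩
    exact ⟨c + d, (slSpace n).add_mem hc hd, fun x => by
      rw [Matrix.add_mulVec, ← hX, ← hY]; rfl⟩
  zero_mem' := ⟨0, (slSpace n).zero_mem, fun x => by rw [Matrix.zero_mulVec]; rfl⟩
  smul_mem' := by
    rintro a X ⟨c, hc, hX⟩
    exact ⟨a • c, (slSpace n).smul_mem a hc, fun x => by
      rw [Matrix.smul_mulVec, ← hX]; rfl⟩

/-- The differential at `γ` of the action of `c` on `M_n(S¹)`, `X ↦ c X`, where `γ' = c γ`. -/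
noncomputable def tangentMap {n : ℕ} (c : SLn n) {γ γ' : Curve n} (h : c • γ = γ') :
    Tangent γ →ₗ[ℝ] Tangent γ' where
  toFun X := ⟨fun x => c.1.mulVec (X.1 x), h ▸ mulVec_mem_tangent c γ X⟩
  map_add' X Y := Subtype.ext (funext fun x => Matrix.mulVec_add c.1 (X.1 x) (Y.1 x))
  map_smul' a X := Subtype.ext (funext fun x => Matrix.mulVec_smul c.1 a (X.1 x))

theorem orbitTangent_le {n : ℕ} (c : SLn n) {γ γ' : Curve n} (h : c • γ = γ') :
    orbitTangent γ ≤ (orbitTangent γ').comap (tangentMap c h) := by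
  rintro X ⟨c₀, h₀, hX⟩
  refine ⟨c.1 * c₀ * c⁻¹.1, ?_, fun x => ?_⟩
  · have h1 : c⁻¹.1 * c.1 = 1 := congrArg Subtype.val (inv_mul_cancel c)
    have : (c.1 * c₀ * c⁻¹.1).trace = c₀.trace := by
      rw [Matrix.trace_mul_comm, ← Matrix.mul_assoc, h1, Matrix.one_mul]
    exact this.trans h₀
  · have h1 : c⁻¹.1 * c.1 = 1 := congrArg Subtype.val (inv_mul_cancel c)
    subst h
    change c.1.mulVec (X.1 x) = (c.1 * c₀ * c⁻¹.1).mulVec (c.1.mulVec (γ.toFun x))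
    rw [hX, Matrix.mulVec_mulVec, Matrix.mulVec_mulVec, Matrix.mul_assoc _ _ c.1, h1,
      Matrix.mul_one]

/-- The normal space `T_γ M / T_γ(orbit)`. -/
abbrev NormalSpace {n : ℕ} (γ : Curve n) : Type := Tangent γ ⧸ orbitTangent γ

/-- The linear map `T_γ M / T_γ(orbit) → T_{cγ} M / T_{cγ}(orbit)` induced by `c`. -/
noncomputable def normalMap {n : ℕ} (c : SLn n) {γ γ' : Curve n} (h : c • γ = γ') :
    NormalSpace γ →ₗ[ℝ] NormalSpace γ' :=
  (orbitTangent γ).mapQ (orbitTangent γ') (tangentMap c h) (orbitTangent_le c h)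

/-- The orbit space `M_n(S¹) / SL(n, ℝ)`. -/
abbrev OrbitSpace (n : ℕ) : Type := MulAction.orbitRel.Quotient (SLn n) (Curve n)

/-- The projection `q : M_n(S¹) → M_n(S¹) / SL(n, ℝ)`. -/
noncomputable def proj {n : ℕ} (γ : Curve n) : OrbitSpace n := Quotient.mk _ γ

/-- All choices of an element of `T_γ M / T_γ(orbit)` for each `γ` in the orbit `p`. -/
abbrev NormalField {n : ℕ} (p : OrbitSpace n) : Type :=
  ∀ γ : {γ : Curve n // proj γ = p}, NormalSpace γ.1

noncomputable instance {n : ℕ} (p : OrbitSpace n) : AddCommGroup (NormalField p) :=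
  Pi.addCommGroup

noncomputable instance {n : ℕ} (p : OrbitSpace n) : Module ℝ (NormalField p) :=
  Pi.module _ _ _

/-- The tangent space of the orbit space at `p`. Since the action is free, `T_p` is
`T_γ M / T_γ(orbit)` for each `γ` in the orbit `p`, where the spaces for different `γ` are identified
through the action. So a tangent vector is an equivariant choice of an element of
`T_γ M / T_γ(orbit)` for all `γ` in the orbit. -/
def OrbitTangentSpace {n : ℕ} (p : OrbitSpace n) :
    Submodule ℝ (NormalField p) where
  carrier := {ξ | ∀ (γ γ' : {γ : Curve n // proj γ = p}) (c : SLn n) (h : c • γ.1 = γ'.1),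
    ξ γ' = normalMap c h (ξ γ)}
  add_mem' hξ hη γ γ' c h := by simp only [Pi.add_apply, map_add, ← hξ γ γ' c h, ← hη γ γ' c h]
  zero_mem' γ γ' c h := by simp only [Pi.zero_apply, map_zero]
  smul_mem' a ξ hξ γ γ' c h := by simp only [Pi.smul_apply, map_smul, ← hξ γ γ' c h]

theorem exists_smul_of_proj_eq {n : ℕ} {γ γ' : Curve n} (h : proj γ' = proj γ) :
    ∃ c : SLn n, c • γ = γ' :=
  MulAction.orbitRel_apply.mp (Quotient.exact h)

/-- The differential `dq_γ` of the projection `q`: the image of `X` is represented at `c γ` by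
the class of `c X`. -/
noncomputable def dProj {n : ℕ} (γ : Curve n) (X : Tangent γ) : OrbitTangentSpace (proj γ) :=
  ⟨fun γ' => normalMap (exists_smul_of_proj_eq γ'.2).choose
      (exists_smul_of_proj_eq γ'.2).choose_spec ((orbitTangent γ).mkQ X), by
    intro γ₁ γ₂ c h
    have h₁ := (exists_smul_of_proj_eq γ₁.2).choose_spec
    have h₂ := (exists_smul_of_proj_eq γ₂.2).choose_spec
    have hc : (exists_smul_of_proj_eq γ₂.2).choose
        = c * (exists_smul_of_proj_eq γ₁.2).choose :=
      smul_injective (γ := γ) (by rw [h₂, mul_smul, h₁, h])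
    simp only [normalMap, Submodule.mapQ_apply, Submodule.mkQ_apply]
    congr 1
    refine Subtype.ext (funext fun x => ?_)
    change (exists_smul_of_proj_eq γ₂.2).choose.1.mulVec (X.1 x)
      = c.1.mulVec ((exists_smul_of_proj_eq γ₁.2).choose.1.mulVec (X.1 x))
    rw [hc, Matrix.mulVec_mulVec]
    rfl⟩

/-! ### Smooth families and closed 2-forms -/

/-- A smooth `k`-parameter family in `M_n(S¹)`. -/
structure Family (n k : ℕ) where
  toFun : EuclideanSpace ℝ (Fin k) → Curve n
  smooth : ContDiff ℝ ∞ fun p : EuclideanSpace ℝ (Fin k) × ℝ => (toFun p.1).toFun p.2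

theorem hasDerivAt_det {n : ℕ} {A : ℝ → Matrix (Fin n) (Fin n) ℝ} {A' : Matrix (Fin n) (Fin n) ℝ}
    {t : ℝ} (hA : ∀ i j, HasDerivAt (fun s => A s i j) (A' i j) t) :
    HasDerivAt (fun s => (A s).det) (∑ i, ((A t).updateCol i fun k => A' k i).det) t := by
  simp only [Matrix.det_apply]
  rw [Finset.sum_comm]
  refine HasDerivAt.fun_sum fun τ _ => ?_
  have h := (HasDerivAt.fun_finsetProd (u := Finset.univ) (f := fun i s => A s (τ i) i)
    (f' := fun i => A' (τ i) i) (x := t) fun i _ => hA (τ i) i).const_smul (Equiv.Perm.sign τ)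
  refine h.congr_deriv ?_
  rw [Finset.smul_sum]
  refine Finset.sum_congr rfl fun i _ => ?_
  congr 1
  rw [← Finset.prod_erase_mul _ _ (Finset.mem_univ i), smul_eq_mul]
  congr 1
  · refine Finset.prod_congr rfl fun j hj => ?_
    rw [Matrix.updateCol_ne (Finset.ne_of_mem_erase hj)]
  · rw [Matrix.updateCol_self]

section Derivatives

variable {E F : Type} [NormedAddCommGroup E] [NormedSpace ℝ E] [NormedAddCommGroup F]
  [NormedSpace ℝ F]

/-- The derivative of `f` in the constant direction `v`. -/
noncomputable def dirDeriv (v : E) (f : E → F) (p : E) : F := fderiv ℝ f p v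

theorem dirDeriv_contDiff (v : E) {f : E → F} (hf : ContDiff ℝ ∞ f) :
    ContDiff ℝ ∞ (dirDeriv v f) :=
  (hf.fderiv_right (m := ∞) (by simp)).clm_apply contDiff_const

theorem dirDeriv_comm (v w : E) {f : E → F} (hf : ContDiff ℝ ∞ f) :
    dirDeriv v (dirDeriv w f) = dirDeriv w (dirDeriv v f) := by
  funext p
  have h1 : DifferentiableAt ℝ (fderiv ℝ f) p :=
    (hf.fderiv_right (m := ∞) (by simp)).differentiable (by simp) p
  have h2 : IsSymmSndFDerivAt ℝ f p :=
    hf.contDiffAt.isSymmSndFDerivAt (by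
      rw [minSmoothness_of_isRCLikeNormedField]
      exact WithTop.coe_le_coe.mpr (le_top : (2 : ℕ∞) ≤ ⊤))
  have key : ∀ a b : E, dirDeriv a (dirDeriv b f) p = fderiv ℝ (fderiv ℝ f) p a b := by
    intro a b
    have := (h1.hasFDerivAt.clm_apply (hasFDerivAt_const b p)).fderiv
    change fderiv ℝ (fun y => fderiv ℝ f y b) p a = _
    rw [this]
    simp
  rw [key, key]
  exact h2 v w

theorem iterate_dirDeriv_contDiff (v : E) {f : E → F} (hf : ContDiff ℝ ∞ f) (k : ℕ) :
    ContDiff ℝ ∞ ((dirDeriv v)^[k] f) := by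
  induction k with
  | zero => exact hf
  | succ k ih =>
    rw [Function.iterate_succ_apply']
    exact dirDeriv_contDiff v ih

theorem iterate_dirDeriv_comm (v w : E) {f : E → F} (hf : ContDiff ℝ ∞ f) (k : ℕ) :
    (dirDeriv v)^[k] (dirDeriv w f) = dirDeriv w ((dirDeriv v)^[k] f) := by
  induction k with
  | zero => rfl
  | succ k ih =>
    rw [Function.iterate_succ_apply', Function.iterate_succ_apply', ih,
      dirDeriv_comm v w (iterate_dirDeriv_contDiff v hf k)]

theorem iteratedDeriv_slice {f : E × ℝ → F} (hf : ContDiff ℝ ∞ f) (k : ℕ) (s : E) (x : ℝ) :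
    iteratedDeriv k (fun y => f (s, y)) x = (dirDeriv ((0 : E), (1 : ℝ)))^[k] f (s, x) := by
  induction k generalizing x with
  | zero => simp
  | succ k ih =>
    rw [iteratedDeriv_succ, funext ih, Function.iterate_succ_apply']
    have h1 : HasDerivAt (fun y : ℝ => (s, y)) ((0 : E), (1 : ℝ)) x :=
      (hasDerivAt_const x s).prodMk (hasDerivAt_id x)
    exact (((iterate_dirDeriv_contDiff _ hf k).differentiable (by simp)
      (s, x)).hasFDerivAt.comp_hasDerivAt x h1).deriv

theorem fderiv_slice {f : E × ℝ → F} (hf : ContDiff ℝ ∞ f) (s v : E) (x : ℝ) :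
    fderiv ℝ (fun t => f (t, x)) s v = dirDeriv (v, (0 : ℝ)) f (s, x) := by
  have h1 : HasFDerivAt (fun t : E => (t, x)) (ContinuousLinearMap.inl ℝ E ℝ) s :=
    (hasFDerivAt_id s).prodMk (hasFDerivAt_const x s)
  have h2 := ((hf.differentiable (by simp) (s, x)).hasFDerivAt.comp s h1).fderiv
  change fderiv ℝ (f ∘ fun t : E => (t, x)) s v = _
  rw [h2]
  simp [dirDeriv]

end Derivatives

theorem velocity_mem {n k : ℕ} (σ : Family n k) (s v : EuclideanSpace ℝ (Fin k)) :
    (fun x => fderiv ℝ (fun t => (σ.toFun t).toFun x) s v) ∈ Tangent (σ.toFun s) := by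
  set f : EuclideanSpace ℝ (Fin k) × ℝ → Fin n → ℝ := fun p => (σ.toFun p.1).toFun p.2 with hf
  have hs : ContDiff ℝ ∞ f := σ.smooth
  have hv : (fun x => fderiv ℝ (fun t => (σ.toFun t).toFun x) s v)
      = fun x => dirDeriv (v, (0 : ℝ)) f (s, x) := funext fun x => fderiv_slice hs s v x
  refine ⟨⟨?_, fun x => ?_⟩, fun x => ?_⟩
  · rw [hv]
    exact (dirDeriv_contDiff _ hs).comp (contDiff_const.prodMk contDiff_id)
  · simp only [fun t => (σ.toFun t).smooth.periodic x]
  · have hcol : ∀ i j : Fin n, HasDerivAt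
        (fun r : ℝ => frame (σ.toFun (s + r • v)).toFun x i j)
        (frame (fun x => fderiv ℝ (fun t => (σ.toFun t).toFun x) s v) x i j) 0 := by
      intro i j
      have hl : HasDerivAt (fun r : ℝ => (s + r • v, x)) (v, (0 : ℝ)) 0 := by
        have := ((hasDerivAt_id (0 : ℝ)).smul_const v).const_add s
        simp only [one_smul] at this
        exact this.prodMk (hasDerivAt_const 0 x)
      have hg := (iterate_dirDeriv_contDiff ((0 : EuclideanSpace ℝ (Fin k)), (1 : ℝ)) hs j)
      have h1 := ((hg.differentiable (by simp) (s + (0 : ℝ) • v, x)).hasFDerivAt.comp_hasDerivAt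
        (0 : ℝ) hl)
      have h2 := hasDerivAt_pi.mp h1 i
      have e1 : (fun r : ℝ => frame (σ.toFun (s + r • v)).toFun x i j)
          = fun r : ℝ => (dirDeriv ((0 : EuclideanSpace ℝ (Fin k)), (1 : ℝ)))^[(j : ℕ)] f
            (s + r • v, x) i :=
        funext fun r => congrFun (iteratedDeriv_slice hs j (s + r • v) x) i
      rw [e1]
      refine h2.congr_deriv ?_
      simp only [frame, Matrix.of_apply]
      rw [hv, iteratedDeriv_slice (dirDeriv_contDiff _ hs), iterate_dirDeriv_comm _ _ hs]
      simp [dirDeriv]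
    have h1 := hasDerivAt_det hcol
    simp only [Curve.det_frame, zero_smul, add_zero] at h1
    exact h1.unique (hasDerivAt_const (0 : ℝ) (1 : ℝ))

/-- The velocity of a smooth family at the parameter `s` in the direction `v`. -/
noncomputable def Family.velocity {n k : ℕ} (σ : Family n k) (s v : EuclideanSpace ℝ (Fin k)) :
    Tangent (σ.toFun s) :=
  ⟨fun x => fderiv ℝ (fun t => (σ.toFun t).toFun x) s v, velocity_mem σ s v⟩

/-- `β` is a bilinear skew-symmetric form. -/
structure IsSkewBilinear {T : Type} [AddCommGroup T] [Module ℝ T] (β : T → T → ℝ) : Prop where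
  add_left : ∀ X Y Z, β (X + Y) Z = β X Z + β Y Z
  smul_left : ∀ (a : ℝ) X Y, β (a • X) Y = a * β X Y
  skew : ∀ X Y, β X Y = - β Y X

/-- `β s v w` is, as a function of `s`, a smooth closed 2-form on `ℝᵏ`. -/
def IsSmoothClosed {k : ℕ}
    (β : EuclideanSpace ℝ (Fin k) → EuclideanSpace ℝ (Fin k) → EuclideanSpace ℝ (Fin k) → ℝ) :
    Prop :=
  ∃ η : EuclideanSpace ℝ (Fin k) → EuclideanSpace ℝ (Fin k) [⋀^Fin 2]→L[ℝ] ℝ,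
    ContDiff ℝ ∞ η ∧ (∀ s v w, η s ![v, w] = β s v w) ∧ ∀ s, extDeriv η s = 0

/-- `Ω` is a smooth closed 2-form on `M_n(S¹)`: it is a skew-symmetric bilinear form on each tangent
space, and its pull-back by each smooth finite-dimensional family is smooth and closed. -/
def IsClosedTwoForm {n : ℕ} (Ω : ∀ γ : Curve n, Tangent γ → Tangent γ → ℝ) : Prop :=
  (∀ γ, IsSkewBilinear (Ω γ)) ∧
  ∀ (k : ℕ) (σ : Family n k), IsSmoothClosed fun s v w =>
    Ω (σ.toFun s) (σ.velocity s v) (σ.velocity s w)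

/-- `Ω` is a smooth closed 2-form on the orbit space. The smooth families in the orbit space are,
locally, the `q ∘ σ` for smooth families `σ` in `M_n(S¹)`. -/
def IsClosedTwoFormOnOrbits {n : ℕ}
    (Ω : ∀ p : OrbitSpace n, OrbitTangentSpace p → OrbitTangentSpace p → ℝ) : Prop :=
  (∀ p, IsSkewBilinear (Ω p)) ∧
  ∀ (k : ℕ) (σ : Family n k), IsSmoothClosed fun s v w =>
    Ω (proj (σ.toFun s)) (dProj (σ.toFun s) (σ.velocity s v)) (dProj (σ.toFun s) (σ.velocity s w))

/-- A weak symplectic form on the orbit space: a closed 2-form `Ω` such that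
`Ω_p(ξ, η) = 0` for all `η` implies `ξ = 0`. -/
structure IsWeakSymplecticOnOrbits {n : ℕ}
    (Ω : ∀ p : OrbitSpace n, OrbitTangentSpace p → OrbitTangentSpace p → ℝ) : Prop where
  closed : IsClosedTwoFormOnOrbits Ω
  nondegenerate : ∀ p ξ, (∀ η, Ω p ξ η = 0) → ξ = 0

end CentralAffine

open CentralAffine

/-! Write `A = g⁻¹ g_x = b + u` and `M_X = g⁻¹ δ_X g`. Everything rests on one identity, `dΨ_γ(X) =
[∂_x + A, M_X]` (`dCurvature_eq`): varying `g` and differentiating it in `x` commute. The frame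
makes this bracket `V_n`-valued (`laxBracket_logVar_mem`), because differentiating a column of `g`
or `δg`, other than the last, gives the next column, and the trace of `M_X` vanishes.

Poisson structure. Pairing with a `V_n`-valued loop sees only the last row, without the corner,
which is the part of `P_u(v)` prescribed by `v`; and `[∂_x + A, ·]` is skew for the pairing. Hence
the bracket of two functionals can be computed with `M_X` in place of `P_u(∇F)`. Since `M_X` is
itself a `P_u(v)`, every `X` is Hamiltonian, for a linear functional.

Closedness. On a family, `M_a = g⁻¹ ∂_a g` satisfies the Maurer–Cartan equation in the parameters
and `x` together, and the pulled-back form is `∮ tr(∂_v(M_x) M_w) dx` (`Family.wTwo_eq`). The cyclic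
sum of its derivatives is the integral of an `x`-derivative of a periodic function
(`cyclic_sum_eq_dirDeriv`), hence zero.

Kernel. Let `W = [∂_x + A, M_X]` pair to zero with every `M_Y`. The vectors `Y = f γ_x^{(k)} + c γ`,
with `c` correcting the trace, give last rows starting with zeros and then a free `f`; taking for
`f` the entries of `W`, from the bottom row up, forces `W = 0` (`laxBracket_eq_zero_of_wTwo`). As `W
= g⁻¹ (δ_X g · g⁻¹)_x g`, this says that `δ_X g · g⁻¹` is a constant `c₀`, that is `X = c₀ γ`.

Descent. `SL(n, ℝ)` multiplies `g` and `δg` on the left, so it fixes `M_X`, `u` and the form. With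
the kernel equal to the orbit directions, the form descends and becomes nondegenerate. -/

namespace CentralAffine

/-! ### Integrals depending on a parameter, and a criterion for closedness -/

section Analysis

variable {E F : Type} [NormedAddCommGroup E] [NormedSpace ℝ E] [FiniteDimensional ℝ E]
  [NormedAddCommGroup F] [NormedSpace ℝ F]

theorem hasFDerivAt_intervalIntegral_of_contDiff {f : E × ℝ → F} (hf : ContDiff ℝ ∞ f) (a b : ℝ)
    (s : E) :
    HasFDerivAt (fun s => ∫ x in a..b, f (s, x))
      (∫ x in a..b, (fderiv ℝ f (s, x)).comp (ContinuousLinearMap.inl ℝ E ℝ)) s := by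
  have hc : ContDiff ℝ ∞ fun p : E × ℝ => (fderiv ℝ f p).comp (ContinuousLinearMap.inl ℝ E ℝ) :=
    (hf.fderiv_right (m := ∞) (by simp)).clm_comp contDiff_const
  -- Finite dimension makes the ball compact, so the partial derivative has a constant bound near
  -- `s`, which serves as the dominating function.
  have hK : IsCompact (Metric.closedBall s 1 ×ˢ Set.uIcc a b) :=
    (isCompact_closedBall s 1).prod isCompact_uIcc
  obtain ⟨C, hC⟩ := hK.exists_bound_of_continuousOn hc.continuous.continuousOn
  refine (intervalIntegral.hasFDerivAt_integral_of_dominated_of_fderiv_le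
    (F := fun s x => f (s, x))
    (F' := fun s x => (fderiv ℝ f (s, x)).comp (ContinuousLinearMap.inl ℝ E ℝ))
    (bound := fun _ => C) (Metric.closedBall_mem_nhds s one_pos)
    (.of_forall fun t => ?_) ?_ ?_ ?_ ?_ ?_)
  · exact (hf.continuous.comp (by fun_prop : Continuous fun x : ℝ => (t, x))).aestronglyMeasurable
  · exact (hf.continuous.comp (by fun_prop : Continuous fun x : ℝ => (s, x))).intervalIntegrable _ _
  · exact (hc.continuous.comp
      (by fun_prop : Continuous fun x : ℝ => (s, x))).aestronglyMeasurable
  · exact .of_forall fun x hx t ht => hC (t, x) ⟨ht, Set.uIoc_subset_uIcc hx⟩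
  · exact intervalIntegrable_const
  · refine .of_forall fun x _ t _ => ?_
    have h1 : HasFDerivAt (fun t : E => (t, x)) (ContinuousLinearMap.inl ℝ E ℝ) t :=
      (hasFDerivAt_id t).prodMk (hasFDerivAt_const x t)
    exact (hf.differentiable (by simp) (t, x)).hasFDerivAt.comp t h1

theorem fderiv_intervalIntegral_apply [CompleteSpace F] {f : E × ℝ → F} (hf : ContDiff ℝ ∞ f) (a b : ℝ) (s v : E) :
    fderiv ℝ (fun s => ∫ x in a..b, f (s, x)) s v
      = ∫ x in a..b, dirDeriv (v, (0 : ℝ)) f (s, x) := by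
  rw [(hasFDerivAt_intervalIntegral_of_contDiff hf a b s).fderiv,
    ContinuousLinearMap.intervalIntegral_apply]
  · rfl
  · have hc : ContDiff ℝ ∞ fun p : E × ℝ => (fderiv ℝ f p).comp (ContinuousLinearMap.inl ℝ E ℝ) :=
      (hf.fderiv_right (m := ∞) (by simp)).clm_comp contDiff_const
    exact (hc.continuous.comp (by fun_prop : Continuous fun x : ℝ => (s, x))).intervalIntegrable _ _

theorem contDiff_intervalIntegral [CompleteSpace F] {f : E × ℝ → F} (hf : ContDiff ℝ ∞ f) (a b : ℝ) :
    ContDiff ℝ ∞ fun s => ∫ x in a..b, f (s, x) := by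
  refine contDiff_infty.mpr fun m => ?_
  -- The directional derivatives are integrals of the same kind with another smooth integrand, hence
  -- an induction on the order for all integrands at once.
  induction m generalizing f with
  | zero =>
    exact contDiff_zero.mpr (continuous_iff_continuousAt.mpr fun s =>
      (hasFDerivAt_intervalIntegral_of_contDiff hf a b s).continuousAt)
  | succ m ih =>
    refine contDiff_succ_iff_fderiv_apply.mpr
      ⟨fun s => (hasFDerivAt_intervalIntegral_of_contDiff hf a b s).differentiableAt,
        fun h => absurd h (WithTop.coe_ne_top (a := (m : ℕ∞))),
        fun v => ?_⟩
    simp only [fderiv_intervalIntegral_apply hf]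
    exact ih (dirDeriv_contDiff _ hf)

end Analysis

/-- On constant vector fields the invariant formula for the exterior derivative has no Lie bracket
terms; only the cyclic sum remains. -/
theorem isSmoothClosed_of_cyclic {k : ℕ}
    {β : EuclideanSpace ℝ (Fin k) → EuclideanSpace ℝ (Fin k) → EuclideanSpace ℝ (Fin k) → ℝ}
    (hβ : ∀ s, IsSkewBilinear (β s)) (hs : ∀ v w, ContDiff ℝ ∞ fun s => β s v w)
    (hc : ∀ s z v w, fderiv ℝ (fun s => β s v w) s z + fderiv ℝ (fun s => β s w z) s v
      + fderiv ℝ (fun s => β s z v) s w = 0) :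
    IsSmoothClosed β := by
  let E := EuclideanSpace ℝ (Fin k)
  have add_right : ∀ s X Y Z, β s X (Y + Z) = β s X Y + β s X Z := fun s X Y Z => by
    rw [(hβ s).skew, (hβ s).add_left, (hβ s).skew Y, (hβ s).skew Z]; ring
  have smul_right : ∀ s (a : ℝ) X Y, β s X (a • Y) = a * β s X Y := fun s a X Y => by
    rw [(hβ s).skew, (hβ s).smul_left, (hβ s).skew Y]; ring
  let B : E → E →L[ℝ] E →L[ℝ] ℝ := fun s => (LinearMap.mk₂ ℝ (β s) (hβ s).add_left
    (hβ s).smul_left (add_right s) (smul_right s)).toContinuousBilinearMap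
  have hB : ContDiff ℝ ∞ B := contDiff_clm_apply_iff.mpr fun v =>
    contDiff_clm_apply_iff.mpr fun w => hs v w
  let J : (E →L[ℝ] ℝ) →L[ℝ] (E [⋀^Fin 1]→L[ℝ] ℝ) :=
    (ContinuousAlternatingMap.ofSubsingletonLIE (𝕜 := ℝ) (E := E) (F := ℝ)
      (0 : Fin 1)).toContinuousLinearEquiv.toContinuousLinearMap
  let T : (E →L[ℝ] E [⋀^Fin 1]→L[ℝ] ℝ) →L[ℝ] E [⋀^Fin 2]→L[ℝ] ℝ :=
    ContinuousAlternatingMap.alternatizeUncurryFinCLM ℝ E ℝ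
  -- Alternating a skew form doubles it, hence the factor `2⁻¹`.
  let η : E → E [⋀^Fin 2]→L[ℝ] ℝ := fun s => T (J.comp ((2⁻¹ : ℝ) • B s))
  have hJ : ContDiff ℝ ∞ fun s => J.comp ((2⁻¹ : ℝ) • B s) :=
    contDiff_const.clm_comp (hB.const_smul (2⁻¹ : ℝ))
  have hη : ContDiff ℝ ∞  η := by
    have hT : ContDiff ℝ ∞ (fun L => T L) :=
      ContinuousLinearMap.contDiff (𝕜 := ℝ) (E := E →L[ℝ] E [⋀^Fin 1]→L[ℝ] ℝ)
        (F := E [⋀^Fin 2]→L[ℝ] ℝ) (n := ∞) T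
    exact hT.comp hJ
  have happ : ∀ s (v : Fin 2 → E), η s v = β s (v 0) (v 1) := by
    intro s v
    change ContinuousAlternatingMap.alternatizeUncurryFin _ v = _
    rw [ContinuousAlternatingMap.alternatizeUncurryFin_apply, Fin.sum_univ_two]
    have e0 : (J.comp ((2⁻¹ : ℝ) • B s)) (v 0) ((0 : Fin 2).removeNth v)
        = 2⁻¹ * β s (v 0) (v 1) := rfl
    have e1 : (J.comp ((2⁻¹ : ℝ) • B s)) (v 1) ((1 : Fin 2).removeNth v)
        = 2⁻¹ * β s (v 1) (v 0) := rfl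
    rw [e0, e1, (hβ s).skew (v 1)]
    simp
    ring
  refine ⟨η, hη, fun s v w => happ s _, fun s => ?_⟩
  ext v
  rw [extDeriv_apply (hη.differentiable (by simp) s), Fin.sum_univ_three]
  simp only [happ]
  have h := hc s (v 0) (v 1) (v 2)
  have h2 : fderiv ℝ (fun s => β s (v 2) (v 0)) s (v 1)
      = - fderiv ℝ (fun s => β s (v 0) (v 2)) s (v 1) := by
    have : (fun s => β s (v 2) (v 0)) = fun s => - β s (v 0) (v 2) :=
      funext fun s => (hβ s).skew _ _
    rw [this, fderiv_fun_neg]; rfl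
  rw [h2] at h
  have e0 : ∀ s, β s ((0 : Fin 3).removeNth v 0) ((0 : Fin 3).removeNth v 1)
    = β s (v 1) (v 2) := fun _ => rfl
  have e1 : ∀ s, β s ((1 : Fin 3).removeNth v 0) ((1 : Fin 3).removeNth v 1)
    = β s (v 0) (v 2) := fun _ => rfl
  have e2 : ∀ s, β s ((2 : Fin 3).removeNth v 0) ((2 : Fin 3).removeNth v 1)
    = β s (v 0) (v 1) := fun _ => rfl
  simp only [e0, e1, e2]
  simp
  linarith

/-! ### Entrywise calculus of matrix-valued maps -/

section MatrixCalculus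

variable {E : Type} [NormedAddCommGroup E] [NormedSpace ℝ E] {n : ℕ}
  {A B : E → Matrix (Fin n) (Fin n) ℝ}

/-- The matrix-valued map `A` has smooth entries. -/
def MSmooth (A : E → Matrix (Fin n) (Fin n) ℝ) : Prop := ∀ i j, ContDiff ℝ ∞ fun p => A p i j

/-- The entrywise derivative of a matrix-valued map in the constant direction `v`. -/
noncomputable def mDeriv (v : E) (A : E → Matrix (Fin n) (Fin n) ℝ) :
    E → Matrix (Fin n) (Fin n) ℝ :=
  fun p => Matrix.of fun i j => dirDeriv v (fun q => A q i j) p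

theorem MSmooth.add (hA : MSmooth A) (hB : MSmooth B) : MSmooth (A + B) :=
  fun i j => (hA i j).add (hB i j)

theorem MSmooth.sub (hA : MSmooth A) (hB : MSmooth B) : MSmooth (A - B) :=
  fun i j => (hA i j).sub (hB i j)

theorem MSmooth.mul (hA : MSmooth A) (hB : MSmooth B) : MSmooth (A * B) := fun i j => by
  simp only [Pi.mul_apply, Matrix.mul_apply]
  exact ContDiff.sum fun k _ => (hA i k).mul (hB k j)

theorem MSmooth.mDeriv (hA : MSmooth A) (v : E) : MSmooth (mDeriv v A) :=
  fun i j => dirDeriv_contDiff v (hA i j)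

theorem MSmooth.trace (hA : MSmooth A) : ContDiff ℝ ∞ fun p => (A p).trace :=
  ContDiff.sum fun i _ => hA i i

theorem MSmooth.det (hA : MSmooth A) : ContDiff ℝ ∞ fun p => (A p).det := by
  simp only [Matrix.det_apply]
  exact ContDiff.sum fun σ _ => ContDiff.const_smul _ (contDiff_prod fun i _ => hA (σ i) i)

/-- With determinant 1 the inverse is polynomial in the entries, which makes its smoothness
immediate. -/
theorem nonsing_inv_eq_adjugate {M : Matrix (Fin n) (Fin n) ℝ} (h : M.det = 1) :
    M⁻¹ = M.adjugate := by
  rw [Matrix.inv_def, h, Ring.inverse_one, one_smul]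

theorem MSmooth.adjugate (hA : MSmooth A) : MSmooth fun p => (A p).adjugate := fun i j => by
  simp only [Matrix.adjugate_apply]
  refine MSmooth.det fun k l => ?_
  simp only [Matrix.updateRow_apply]
  split_ifs
  · exact contDiff_const
  · exact hA k l

theorem MSmooth.inv (hA : MSmooth A) (h : ∀ p, (A p).det = 1) : MSmooth fun p => (A p)⁻¹ := by
  simp only [fun p => nonsing_inv_eq_adjugate (h p)]
  exact hA.adjugate

theorem dirDeriv_fun_add {f g : E → ℝ} (hf : ContDiff ℝ ∞ f) (hg : ContDiff ℝ ∞ g) (v p : E) :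
    dirDeriv v (fun q => f q + g q) p = dirDeriv v f p + dirDeriv v g p := by
  rw [dirDeriv, fderiv_fun_add (hf.differentiable (by simp) p) (hg.differentiable (by simp) p)]
  rfl

theorem dirDeriv_fun_sub {f g : E → ℝ} (hf : ContDiff ℝ ∞ f) (hg : ContDiff ℝ ∞ g) (v p : E) :
    dirDeriv v (fun q => f q - g q) p = dirDeriv v f p - dirDeriv v g p := by
  rw [dirDeriv, fderiv_fun_sub (hf.differentiable (by simp) p) (hg.differentiable (by simp) p)]
  rfl

theorem dirDeriv_fun_mul {f g : E → ℝ} (hf : ContDiff ℝ ∞ f) (hg : ContDiff ℝ ∞ g) (v p : E) :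
    dirDeriv v (fun q => f q * g q) p = dirDeriv v f p * g p + f p * dirDeriv v g p := by
  rw [dirDeriv, fderiv_fun_mul (hf.differentiable (by simp) p) (hg.differentiable (by simp) p)]
  simp [dirDeriv]
  ring

theorem dirDeriv_fun_sum {ι : Type} [Fintype ι] {f : ι → E → ℝ} (hf : ∀ i, ContDiff ℝ ∞ (f i))
    (v p : E) : dirDeriv v (fun q => ∑ i, f i q) p = ∑ i, dirDeriv v (f i) p := by
  rw [dirDeriv, fderiv_fun_sum fun i _ => (hf i).differentiable (by simp) p]
  simp [dirDeriv]

theorem mDeriv_add (hA : MSmooth A) (hB : MSmooth B) (v : E) :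
    mDeriv v (A + B) = mDeriv v A + mDeriv v B :=
  funext fun p => Matrix.ext fun i j => dirDeriv_fun_add (hA i j) (hB i j) v p

theorem mDeriv_sub (hA : MSmooth A) (hB : MSmooth B) (v : E) :
    mDeriv v (A - B) = mDeriv v A - mDeriv v B :=
  funext fun p => Matrix.ext fun i j => dirDeriv_fun_sub (hA i j) (hB i j) v p

theorem mDeriv_mul (hA : MSmooth A) (hB : MSmooth B) (v : E) :
    mDeriv v (A * B) = mDeriv v A * B + A * mDeriv v B := by
  funext p
  ext i j
  simp only [mDeriv, Matrix.of_apply, Pi.mul_apply, Pi.add_apply, Matrix.add_apply,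
    Matrix.mul_apply]
  rw [dirDeriv_fun_sum fun k => (hA i k).mul (hB k j), ← Finset.sum_add_distrib]
  exact Finset.sum_congr rfl fun k _ => dirDeriv_fun_mul (hA i k) (hB k j) v p

theorem mDeriv_const (M : Matrix (Fin n) (Fin n) ℝ) (v : E) :
    mDeriv v (fun _ => M) = 0 := by
  funext p
  ext i j
  simp [mDeriv, dirDeriv]

theorem mDeriv_comm (hA : MSmooth A) (v w : E) :
    mDeriv v (mDeriv w A) = mDeriv w (mDeriv v A) :=
  funext fun p => Matrix.ext fun i j => congrFun (dirDeriv_comm v w (hA i j)) p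

theorem dirDeriv_trace (hA : MSmooth A) (v p : E) :
    dirDeriv v (fun q => (A q).trace) p = (mDeriv v A p).trace :=
  dirDeriv_fun_sum (fun i => hA i i) v p

theorem mDeriv_leftInverse (hA : MSmooth A) (hB : MSmooth B) (h : B * A = 1) (v : E) :
    mDeriv v B = - (B * mDeriv v A * B) := by
  have h1 : mDeriv v B * A + B * mDeriv v A = 0 := by
    rw [← mDeriv_mul hB hA, h]
    exact mDeriv_const 1 v
  have h2 : A * B = 1 := funext fun p => mul_eq_one_comm.mp (congrFun h p)
  calc mDeriv v B = (mDeriv v B * A + B * mDeriv v A) * B - B * mDeriv v A * B := by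
        rw [add_mul, mul_assoc, h2, mul_one, add_sub_cancel_right]
    _ = _ := by rw [h1, zero_mul, zero_sub]

end MatrixCalculus

/-! ### The moving frame and the zero-curvature equation -/

section Frames

variable {n : ℕ}

/-- The matrix-valued map `A` is a smooth loop. -/
def MLoop (A : ℝ → Matrix (Fin n) (Fin n) ℝ) : Prop := ∀ i j, IsSmoothLoop fun x => A x i j

theorem MLoop.smooth {A : ℝ → Matrix (Fin n) (Fin n) ℝ} (hA : MLoop A) : MSmooth A :=
  fun i j => (hA i j).1

theorem MLoop.periodic {A : ℝ → Matrix (Fin n) (Fin n) ℝ} (hA : MLoop A) :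
    Function.Periodic A (2 * Real.pi) :=
  fun x => Matrix.ext fun i j => (hA i j).2 x

theorem MLoop.mk {A : ℝ → Matrix (Fin n) (Fin n) ℝ} (hA : MSmooth A)
    (hp : Function.Periodic A (2 * Real.pi)) : MLoop A :=
  fun i j => ⟨hA i j, fun x => by simp only [hp x]⟩

theorem MLoop.mDeriv {A : ℝ → Matrix (Fin n) (Fin n) ℝ} (hA : MLoop A) :
    MLoop (mDeriv 1 A) := fun i j => by
  have := (hA i j).iteratedDeriv 1
  rwa [iteratedDeriv_one] at this

theorem MLoop.add {A B : ℝ → Matrix (Fin n) (Fin n) ℝ} (hA : MLoop A) (hB : MLoop B) :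
    MLoop (A + B) := fun i j => (hA i j).add (hB i j)

theorem MLoop.mul {A B : ℝ → Matrix (Fin n) (Fin n) ℝ} (hA : MLoop A) (hB : MLoop B) :
    MLoop (A * B) :=
  .mk (hA.smooth.mul hB.smooth) fun x => by simp only [Pi.mul_apply, hA.periodic x, hB.periodic x]

theorem MLoop.sub {A B : ℝ → Matrix (Fin n) (Fin n) ℝ} (hA : MLoop A) (hB : MLoop B) :
    MLoop (A - B) :=
  .mk (hA.smooth.sub hB.smooth) fun x => by simp only [Pi.sub_apply, hA.periodic x, hB.periodic x]

theorem MLoop.const (M : Matrix (Fin n) (Fin n) ℝ) : MLoop fun _ => M :=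
  fun _ _ => ⟨contDiff_const, fun _ => rfl⟩

theorem MLoop.inv {A : ℝ → Matrix (Fin n) (Fin n) ℝ} (hA : MLoop A) (h : ∀ x, (A x).det = 1) :
    MLoop fun x => (A x)⁻¹ :=
  .mk (hA.smooth.inv h) fun x => by simp only [hA.periodic x]

theorem mLoop_frame {X : ℝ → Fin n → ℝ} (hX : IsSmoothLoop X) : MLoop (frame X) :=
  fun i j => isSmoothLoop_apply (hX.iteratedDeriv j) i

theorem IsSmoothLoop.deriv {X : ℝ → Fin n → ℝ} (hX : IsSmoothLoop X) : IsSmoothLoop (deriv X) := by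
  have := hX.iteratedDeriv 1
  rwa [iteratedDeriv_one] at this

theorem frame_deriv_apply (X : ℝ → Fin n → ℝ) (x : ℝ) (i j : Fin n) :
    frame (deriv X) x i j = iteratedDeriv (j + 1) X x i := by
  rw [iteratedDeriv_succ']; rfl

theorem mDeriv_frame {X : ℝ → Fin n → ℝ} (hX : IsSmoothLoop X) :
    mDeriv 1 (frame X) = frame (deriv X) := by
  funext x
  ext i j
  rw [frame_deriv_apply, iteratedDeriv_succ]
  have h := ((hX.iteratedDeriv j).1.differentiable (by simp) x).hasDerivAt
  exact (hasDerivAt_pi.mp h i).deriv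

theorem det_updateCol_eq {M : Matrix (Fin n) (Fin n) ℝ} (h : M.det = 1) (c : Fin n → ℝ)
    (i : Fin n) : (M.updateCol i c).det = (M⁻¹.mulVec c) i := by
  rw [nonsing_inv_eq_adjugate h, ← Matrix.cramer_eq_adjugate_mulVec, Matrix.cramer_apply]

/-- By Cramer's rule each determinant is a diagonal entry of `M⁻¹ * N`. The tangency condition thus
becomes `tr (g⁻¹ δg) = 0`. -/
theorem sum_det_updateCol {M : Matrix (Fin n) (Fin n) ℝ} (h : M.det = 1)
    (N : Matrix (Fin n) (Fin n) ℝ) :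
    ∑ i, (M.updateCol i fun k => N k i).det = (M⁻¹ * N).trace := by
  simp only [det_updateCol_eq h]
  rfl

theorem Curve.inv_mul (γ : Curve n) (x : ℝ) : (frame γ.toFun x)⁻¹ * frame γ.toFun x = 1 :=
  Matrix.nonsing_inv_mul _ (by rw [γ.det_frame]; exact isUnit_one)

theorem Curve.mul_inv (γ : Curve n) (x : ℝ) : frame γ.toFun x * (frame γ.toFun x)⁻¹ = 1 :=
  Matrix.mul_nonsing_inv _ (by rw [γ.det_frame]; exact isUnit_one)

theorem Curve.mLoop_frame (γ : Curve n) : MLoop (frame γ.toFun) :=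
  CentralAffine.mLoop_frame γ.smooth

theorem Curve.mLoop_inv (γ : Curve n) : MLoop fun x => (frame γ.toFun x)⁻¹ :=
  γ.mLoop_frame.inv γ.det_frame

theorem mLoop_logVar (γ : Curve n) (X : Tangent γ) : MLoop (logVar γ X) :=
  γ.mLoop_inv.mul (mLoop_frame X.2.1)

theorem trace_logVar (γ : Curve n) (X : Tangent γ) (x : ℝ) : (logVar γ X x).trace = 0 := by
  rw [logVar, ← sum_det_updateCol (γ.det_frame x)]
  exact X.2.2 x

/-- The inverse frame sends `γ_x^{(j)}` to the basis vector `e_j`. -/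
theorem Curve.inv_mulVec_iteratedDeriv (γ : Curve n) (x : ℝ) (i j : Fin n) :
    ((frame γ.toFun x)⁻¹.mulVec (iteratedDeriv j γ.toFun x)) i = if i = j then 1 else 0 := by
  have := congrFun (congrFun (γ.inv_mul x) i) j
  rw [Matrix.one_apply] at this
  exact this

theorem trace_inv_mul_frame_deriv (γ : Curve n) (x : ℝ) :
    ((frame γ.toFun x)⁻¹ * frame (deriv γ.toFun) x).trace = 0 := by
  rw [← sum_det_updateCol (γ.det_frame x), ← mDeriv_frame γ.smooth]
  have h := hasDerivAt_det (A := frame γ.toFun) (A' := mDeriv 1 (frame γ.toFun) x) (t := x)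
    fun i j => ((γ.mLoop_frame i j).1.differentiable (by simp) x).hasDerivAt
  simp only [γ.det_frame] at h
  exact h.unique (hasDerivAt_const x 1)

/-- `g⁻¹ g_x = b + u`. -/
theorem inv_mul_frame_deriv (γ : Curve n) (x : ℝ) :
    (frame γ.toFun x)⁻¹ * frame (deriv γ.toFun) x = bMatrix n + curvMatrix γ.toFun x := by
  -- Away from the last column, `g_x` is `g` with its columns shifted, which gives `b`.
  have hlt : ∀ i j : Fin n, (j : ℕ) + 1 < n →
      ((frame γ.toFun x)⁻¹ * frame (deriv γ.toFun) x) i j = if (i : ℕ) = j + 1 then 1 else 0 := by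
    intro i j hj
    have h := γ.inv_mulVec_iteratedDeriv x i ⟨j + 1, hj⟩
    simp only [Fin.ext_iff] at h
    rw [← h]
    simp only [Matrix.mul_apply, Matrix.mulVec, dotProduct, frame_deriv_apply]
  ext i j
  by_cases hj : (j : ℕ) + 1 < n
  · rw [hlt i j hj]
    simp [bMatrix, curvMatrix, hj.ne]
  have hj' : (j : ℕ) + 1 = n := by omega
  have hb : bMatrix n i j = 0 := by
    simp only [bMatrix, Matrix.of_apply]; rw [if_neg]; omega
  rw [Matrix.add_apply, hb, zero_add]
  by_cases hi : (i : ℕ) + 1 < n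
  · simp only [curvMatrix, Matrix.of_apply, hi, hj', and_self, if_true]
    rw [det_updateCol_eq (γ.det_frame x)]
    simp only [Matrix.mul_apply, Matrix.mulVec, dotProduct, frame_deriv_apply, hj']
  -- The corner entry is the only diagonal entry not yet known to vanish, and the trace is zero.
  · have hij : i = j := by ext; omega
    subst hij
    have ht := trace_inv_mul_frame_deriv γ x
    rw [Matrix.trace, Finset.sum_eq_single i] at ht
    · simp only [curvMatrix, Matrix.of_apply, hi, false_and, if_false]
      exact ht
    · intro k _ hk
      have hk' : (k : ℕ) + 1 < n := by
        have := k.2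
        have : (k : ℕ) ≠ i := fun h => hk (Fin.ext h)
        omega
      rw [Matrix.diag_apply, hlt k k hk', if_neg (by omega)]
    · simp

theorem frame_deriv_eq (γ : Curve n) (x : ℝ) :
    frame (deriv γ.toFun) x = frame γ.toFun x * (bMatrix n + curvMatrix γ.toFun x) := by
  rw [← inv_mul_frame_deriv, ← mul_assoc, γ.mul_inv, one_mul]

theorem laxBracket_eq (u C : ℝ → Matrix (Fin n) (Fin n) ℝ) (x : ℝ) :
    laxBracket u C x = mDeriv 1 C x + ((bMatrix n + u x) * C x - C x * (bMatrix n + u x)) := rfl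

theorem mDeriv_inv_frame (γ : Curve n) (x : ℝ) :
    mDeriv 1 (fun y => (frame γ.toFun y)⁻¹) x
      = - ((bMatrix n + curvMatrix γ.toFun x) * (frame γ.toFun x)⁻¹) := by
  rw [mDeriv_leftInverse γ.mLoop_frame.smooth γ.mLoop_inv.smooth (funext γ.inv_mul) 1,
    ← inv_mul_frame_deriv, mDeriv_frame γ.smooth]
  rfl

/-- The derivative of `g⁻¹` contributes `-(b + u) g⁻¹ δg`, which cancels the left half of the
commutator. -/
theorem laxBracket_logVar (γ : Curve n) (X : Tangent γ) (x : ℝ) :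
    laxBracket (curvature γ).1 (logVar γ X) x
      = (frame γ.toFun x)⁻¹ * frame (deriv X.1) x
        - logVar γ X x * (bMatrix n + curvMatrix γ.toFun x) := by
  have h : mDeriv 1 (logVar γ X) = mDeriv 1 (fun y => (frame γ.toFun y)⁻¹) * frame X.1
      + (fun y => (frame γ.toFun y)⁻¹) * frame (deriv X.1) := by
    rw [← mDeriv_frame X.2.1]
    exact mDeriv_mul γ.mLoop_inv.smooth (mLoop_frame X.2.1).smooth 1
  rw [laxBracket_eq, h]
  simp only [Pi.add_apply, Pi.mul_apply, mDeriv_inv_frame, curvature, logVar]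
  noncomm_ring

theorem MLoop.laxBracket {u C : ℝ → Matrix (Fin n) (Fin n) ℝ} (hu : MLoop u) (hC : MLoop C) :
    MLoop (laxBracket u C) :=
  hC.mDeriv.add ((((MLoop.const _).add hu).mul hC).sub (hC.mul ((MLoop.const _).add hu)))

theorem trace_laxBracket {u C : ℝ → Matrix (Fin n) (Fin n) ℝ} (hC : MLoop C)
    (h : ∀ x, (C x).trace = 0) (x : ℝ) : (laxBracket u C x).trace = 0 := by
  rw [laxBracket_eq, Matrix.trace_add, Matrix.trace_sub,
    Matrix.trace_mul_comm (C x), sub_self, add_zero, ← dirDeriv_trace hC.smooth]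
  simp [h, dirDeriv]

/-- Away from the last column, both terms of `laxBracket_logVar` are the next column of `g⁻¹ δg`, so
they cancel. The corner vanishes because the trace does. -/
theorem laxBracket_logVar_mem (γ : Curve n) (X : Tangent γ) :
    laxBracket (curvature γ).1 (logVar γ X) ∈ loopsIn (VSpace n) := by
  refine ⟨MLoop.laxBracket (curvature γ).2.1 (mLoop_logVar γ X), fun x => ?_⟩
  have hlt : ∀ i j : Fin n, (j : ℕ) + 1 < n →
      laxBracket (curvature γ).1 (logVar γ X) x i j = 0 := by
    intro i j hj
    rw [laxBracket_logVar, Matrix.sub_apply, sub_eq_zero]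
    have h1 : (logVar γ X x * (bMatrix n + curvMatrix γ.toFun x)) i j
        = logVar γ X x i ⟨j + 1, hj⟩ := by
      rw [Matrix.mul_apply, Finset.sum_eq_single ⟨j + 1, hj⟩]
      · simp [bMatrix, curvMatrix, hj.ne]
      · intro k _ hk
        have : ¬ (k : ℕ) = j + 1 := fun h => hk (Fin.ext h)
        simp [bMatrix, curvMatrix, hj.ne, this]
      · simp
    rw [h1]
    simp only [logVar, Matrix.mul_apply, frame_deriv_apply]
    rfl
  intro i j hij
  by_cases hj : (j : ℕ) + 1 < n
  · exact hlt i j hj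
  have ht := trace_laxBracket (u := (curvature γ).1) (mLoop_logVar γ X) (trace_logVar γ X) x
  have hij : i = j := by ext; omega
  subst hij
  rw [Matrix.trace, Finset.sum_eq_single i] at ht
  · exact ht
  · intro k _ hk
    have : (k : ℕ) ≠ i := fun h => hk (Fin.ext h)
    exact hlt k k (by omega)
  · simp

theorem mSmooth_line (M N : Matrix (Fin n) (Fin n) ℝ) : MSmooth fun s : ℝ => M + s • N :=
  fun _ _ => contDiff_const.add (contDiff_id.mul contDiff_const)

theorem mDeriv_line (M N : Matrix (Fin n) (Fin n) ℝ) :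
    mDeriv 1 (fun s : ℝ => M + s • N) 0 = N := by
  ext k l
  have h : HasDerivAt (fun s : ℝ => (M + s • N) k l) (N k l) 0 := by
    have := ((hasDerivAt_id (0 : ℝ)).mul_const (N k l)).const_add (M k l)
    rwa [one_mul] at this
  exact h.deriv

/-- The linearised zero-curvature equation `dΨ_γ(X) = [∂_x + b + u, g⁻¹ δ_X g]`. -/
theorem dCurvature_eq (γ : Curve n) (X : Tangent γ) :
    dCurvature γ X = laxBracket (curvature γ).1 (logVar γ X) := by
  funext x
  ext i j
  by_cases hij : (i : ℕ) + 1 < n ∧ (j : ℕ) + 1 = n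
  swap
  · rw [(laxBracket_logVar_mem γ X).2 x i j hij]
    simp [dCurvature, curvMatrix, hij]
  let G : ℝ → Matrix (Fin n) (Fin n) ℝ := fun s => frame γ.toFun x + s • frame X.1 x
  have hfr : ∀ s : ℝ, frame (γ.toFun + s • X.1) x = G s := fun s => by
    rw [frame_add γ.smooth (X.2.1.smul s), frame_smul]
  have hG : MSmooth G := mSmooth_line _ _
  have hG' : mDeriv 1 G 0 = frame X.1 x := mDeriv_line _ _
  have hG0 : G 0 = frame γ.toFun x := by simp [G]
  -- The curve `γ + s X` has a frame of determinant 1 only to first order in `s`; tangency of `X`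
  -- enters here.
  have hdet : HasDerivAt (fun s => (G s).det) 0 0 := by
    have h := hasDerivAt_det (A := G) (A' := frame X.1 x) (t := 0) fun k l => by
      rw [← hG']
      exact ((hG k l).differentiable (by simp) 0).hasDerivAt
    rw [hG0] at h
    exact h.congr_deriv (X.2.2 x)
  -- The adjugate replaces the inverse off `s = 0`: Cramer's rule expresses the curvature through it
  -- for every `s`, and `Q G = det G · 1` has derivative zero at `s = 0`.
  let Q : ℝ → Matrix (Fin n) (Fin n) ℝ := fun s => (G s).adjugate
  have hQ : MSmooth Q := hG.adjugate
  have hQ0 : Q 0 = (frame γ.toFun x)⁻¹ := by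
    rw [nonsing_inv_eq_adjugate (γ.det_frame x), ← hG0]
  have hQG : mDeriv 1 (Q * G) 0 = 0 := by
    ext k l
    have h1 : (fun s => (Q * G) s k l)
        = fun s => (G s).det * (1 : Matrix (Fin n) (Fin n) ℝ) k l := funext fun s => by
      simp only [Pi.mul_apply, Q, Matrix.adjugate_mul]; rfl
    have h2 := hdet.mul_const ((1 : Matrix (Fin n) (Fin n) ℝ) k l)
    rw [zero_mul, ← h1] at h2
    exact h2.deriv
  have hQ' : mDeriv 1 Q 0 = - (logVar γ X x * (frame γ.toFun x)⁻¹) := by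
    rw [mDeriv_mul hQ hG, Pi.add_apply, Pi.mul_apply, Pi.mul_apply, hG', hG0, hQ0] at hQG
    have h3 := congrArg (· * (frame γ.toFun x)⁻¹) (eq_neg_of_add_eq_zero_left hQG)
    simp only [mul_assoc, γ.mul_inv, mul_one, neg_mul] at h3
    rw [h3, logVar, mul_assoc]
  let H : ℝ → Matrix (Fin n) (Fin n) ℝ :=
    fun s => frame (deriv γ.toFun) x + s • frame (deriv X.1) x
  have hH : MSmooth H := mSmooth_line _ _
  have hH' : mDeriv 1 H 0 = frame (deriv X.1) x := mDeriv_line _ _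
  have hH0 : H 0 = frame (deriv γ.toFun) x := by simp [H]
  have hval : ∀ s : ℝ, curvMatrix (γ.toFun + s • X.1) x i j = (Q * H) s i j := by
    intro s
    simp only [curvMatrix, Matrix.of_apply, hij, and_self, if_true]
    rw [← Matrix.cramer_apply, Matrix.cramer_eq_adjugate_mulVec, hfr]
    simp only [Matrix.mulVec, dotProduct, Pi.mul_apply, Matrix.mul_apply, Q]
    refine Finset.sum_congr rfl fun k _ => ?_
    congr 1
    have h4 := frame_add γ.smooth.deriv (X.2.1.deriv.smul s) x
    rw [frame_smul] at h4
    have h5 : deriv γ.toFun + s • deriv X.1 = deriv (γ.toFun + s • X.1) := by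
      funext y
      rw [deriv_add (γ.smooth.1.differentiable (by simp) y)
        ((X.2.1.smul s).1.differentiable (by simp) y), deriv_const_smul_field]
      rfl
    change _ = (frame (deriv γ.toFun) x + s • frame (deriv X.1) x) k j
    rw [← h4, h5, frame_deriv_apply, hij.2]
  have hfin : dCurvature γ X x i j = mDeriv 1 (Q * H) 0 i j := by
    simp only [dCurvature, Matrix.of_apply, hval]
    rfl
  rw [hfin, mDeriv_mul hQ hH, laxBracket_logVar, Pi.add_apply, Pi.mul_apply, Pi.mul_apply, hH',
    hQ', hQ0, hH0, ← inv_mul_frame_deriv]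
  refine congrFun (congrFun ?_ i) j
  rw [neg_mul, mul_assoc]
  abel

end Frames

/-! ### The pairing, the second Poisson bracket and the form -/

section TwoForm

variable {n : ℕ}

theorem continuous_trace_mul {A B : ℝ → Matrix (Fin n) (Fin n) ℝ} (hA : MLoop A) (hB : MLoop B) :
    Continuous fun x => (A x * B x).trace :=
  (hA.mul hB).smooth.trace.continuous

theorem pairing_comm (A B : ℝ → Matrix (Fin n) (Fin n) ℝ) : pairing A B = pairing B A := by
  simp only [pairing, fun x => Matrix.trace_mul_comm (A x) (B x)]

theorem pairing_add_left {A B C : ℝ → Matrix (Fin n) (Fin n) ℝ} (hA : MLoop A) (hB : MLoop B)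
    (hC : MLoop C) : pairing (A + B) C = pairing A C + pairing B C := by
  simp only [pairing, Pi.add_apply, Matrix.add_mul, Matrix.trace_add]
  exact intervalIntegral.integral_add ((continuous_trace_mul hA hC).intervalIntegrable _ _)
    ((continuous_trace_mul hB hC).intervalIntegrable _ _)

theorem pairing_smul_left (a : ℝ) (A B : ℝ → Matrix (Fin n) (Fin n) ℝ) :
    pairing (a • A) B = a * pairing A B := by
  simp only [pairing, Pi.smul_apply, Matrix.smul_mul, Matrix.trace_smul, smul_eq_mul,
    intervalIntegral.integral_const_mul]

/-- The two integrands add up to `∂_x tr (A B)`, the commutator terms having trace zero, and the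
integral of this over a period vanishes. -/
theorem pairing_laxBracket {u A B : ℝ → Matrix (Fin n) (Fin n) ℝ} (hu : MLoop u) (hA : MLoop A)
    (hB : MLoop B) : pairing (laxBracket u A) B = - pairing A (laxBracket u B) := by
  rw [← add_eq_zero_iff_eq_neg, pairing, pairing, ← intervalIntegral.integral_add
    ((continuous_trace_mul (hu.laxBracket hA) hB).intervalIntegrable _ _)
    ((continuous_trace_mul hA (hu.laxBracket hB)).intervalIntegrable _ _)]
  have hAB := hA.mul hB
  have h : ∀ x, (laxBracket u A x * B x).trace + (A x * laxBracket u B x).trace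
      = deriv (fun y => ((A * B) y).trace) x := by
    intro x
    have h1 : deriv (fun y => ((A * B) y).trace) x = (mDeriv 1 (A * B) x).trace :=
      dirDeriv_trace hAB.smooth 1 x
    rw [h1, mDeriv_mul hA.smooth hB.smooth]
    simp only [laxBracket_eq, Pi.add_apply, Pi.mul_apply]
    have h2 := Matrix.trace_mul_comm (bMatrix n + u x) (A x * B x)
    simp only [Matrix.add_mul, Matrix.sub_mul, Matrix.mul_add, Matrix.mul_sub, Matrix.trace_add,
      Matrix.trace_sub, Matrix.mul_assoc] at h2 ⊢
    linarith
  simp only [h]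
  rw [intervalIntegral.integral_deriv_eq_sub
    (fun x _ => hAB.smooth.trace.differentiable (by simp) x)
    ((contDiff_infty_iff_deriv.mp hAB.smooth.trace).2.continuous.intervalIntegrable _ _)]
  have := hAB.periodic 0
  rw [zero_add] at this
  rw [this, sub_self]

theorem trace_mul_of_mem_VSpace {W B : Matrix (Fin n) (Fin n) ℝ} (hW : W ∈ VSpace n) {l : Fin n}
    (hl : (l : ℕ) + 1 = n) : (W * B).trace = ∑ i, W i l * B l i := by
  simp only [Matrix.trace, Matrix.diag_apply, Matrix.mul_apply]
  refine Finset.sum_congr rfl fun i _ => ?_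
  refine Finset.sum_eq_single l (fun j _ hj => ?_) (by simp)
  have : (j : ℕ) ≠ l := fun h => hj (Fin.ext h)
  rw [hW i j (by omega), zero_mul]

/-- A matrix in `V_n` lives in the last column above the corner, so it meets only the matching
entries of the last row. -/
theorem pairing_congr_lastRow {W B C : ℝ → Matrix (Fin n) (Fin n) ℝ} (hW : W ∈ loopsIn (VSpace n))
    (h : ∀ (x : ℝ) (i j : Fin n), (i : ℕ) + 1 = n → (j : ℕ) + 1 < n → B x i j = C x i j) :
    pairing W B = pairing W C := by
  rcases Nat.eq_zero_or_pos n with rfl | hn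
  · simp [pairing, Matrix.trace]
  refine congrArg (fun f : ℝ → ℝ => ∫ x in (0 : ℝ)..(2 * Real.pi), f x) (funext fun x => ?_)
  have hl : ((⟨n - 1, by omega⟩ : Fin n) : ℕ) + 1 = n := Nat.sub_add_cancel hn
  rw [trace_mul_of_mem_VSpace (hW.2 x) hl, trace_mul_of_mem_VSpace (hW.2 x) hl]
  refine Finset.sum_congr rfl fun i _ => ?_
  by_cases hi : (i : ℕ) + 1 < n
  · rw [h x _ i hl hi]
  · rw [hW.2 x i _ (fun h => hi h.1), zero_mul, zero_mul]

theorem wTwo_skew (γ : Curve n) (X Y : Tangent γ) : wTwo γ X Y = - wTwo γ Y X := by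
  rw [wTwo, pairing_laxBracket (curvature γ).2.1 (mLoop_logVar γ X) (mLoop_logVar γ Y),
    pairing_comm, wTwo]

theorem logVar_add (γ : Curve n) (X Y : Tangent γ) :
    logVar γ (X + Y) = logVar γ X + logVar γ Y := by
  funext x
  change _ * frame (X.1 + Y.1) x = _
  rw [frame_add X.2.1 Y.2.1, mul_add]
  rfl

theorem logVar_smul (γ : Curve n) (a : ℝ) (X : Tangent γ) :
    logVar γ (a • X) = a • logVar γ X := by
  funext x
  change _ * frame (a • X.1) x = _
  rw [frame_smul, Matrix.mul_smul]
  rfl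

theorem wTwo_isSkewBilinear (γ : Curve n) : IsSkewBilinear (wTwo γ) where
  add_left X Y Z := by
    rw [wTwo_skew, wTwo, pairing_comm, logVar_add, pairing_add_left (mLoop_logVar γ X)
      (mLoop_logVar γ Y) (laxBracket_logVar_mem γ Z).1, wTwo_skew γ X Z, wTwo_skew γ Y Z, wTwo, wTwo,
      pairing_comm _ (logVar γ X), pairing_comm _ (logVar γ Y)]
    ring
  smul_left a X Y := by
    rw [wTwo_skew, wTwo, pairing_comm, logVar_smul, pairing_smul_left, wTwo_skew γ X Y, wTwo,
      pairing_comm _ (logVar γ X)]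
    ring
  skew := wTwo_skew γ

/-- The pairing of `[∂_x + b + u, P_u(v)]` with `P_u(∇F(u))` depends only on `F`. -/
theorem IsPGradient.pairing_eq {F : loopsIn (VSpace n) → ℝ} {u : loopsIn (VSpace n)}
    {C C' : loopsIn (slSpace n)} (h : IsPGradient F u C) (h' : IsPGradient F u C')
    {W : ℝ → Matrix (Fin n) (Fin n) ℝ} (hW : W ∈ loopsIn (VSpace n)) :
    pairing W C.1 = pairing W C'.1 := by
  obtain ⟨v, hv, hC⟩ := h
  obtain ⟨v', hv', hC'⟩ := h'
  rw [pairing_congr_lastRow hW hC.lastRow, pairing_congr_lastRow hW hC'.lastRow,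
    pairing_comm, pairing_comm W]
  exact (hv ⟨W, hW⟩).unique (hv' ⟨W, hW⟩)

/-- The choices `D₁, D₂` behind the bracket may differ from the `C₁, C₂` behind the vector fields.
Uniqueness of `P_u` is avoided: skewness moves the bracket from one slot to the other, and each slot
is exchanged, first `D` for `C`, then `C` for `g⁻¹ δg`, while it is paired with a `V_n`-valued loop
or stands inside the bracket. -/
theorem wTwo_eq_of_isPoissonBracket {γ : Curve n} {F₁ F₂ : loopsIn (VSpace n) → ℝ}
    {X₁ X₂ : Tangent γ} {r : ℝ} (h₁ : IsHamiltonianAt F₁ γ X₁) (h₂ : IsHamiltonianAt F₂ γ X₂)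
    (hr : IsPoissonBracket F₁ F₂ (curvature γ) r) : wTwo γ X₁ X₂ = r := by
  obtain ⟨C₁, hC₁, e₁⟩ := h₁
  obtain ⟨C₂, hC₂, e₂⟩ := h₂
  obtain ⟨D₁, D₂, hD₁, hD₂, rfl⟩ := hr
  have hu : MLoop (curvature γ).1 := (curvature γ).2.1
  rw [dCurvature_eq] at e₁ e₂
  have m₁ : laxBracket (curvature γ).1 D₁.1 ∈ loopsIn (VSpace n) := by
    obtain ⟨v, _, h⟩ := hD₁
    exact h.bracket_mem
  have m₂ : laxBracket (curvature γ).1 C₂.1 ∈ loopsIn (VSpace n) := by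
    obtain ⟨v, _, h⟩ := hC₂
    exact h.bracket_mem
  rw [hD₂.pairing_eq hC₂ m₁, pairing_laxBracket hu D₁.2.1 C₂.2.1, pairing_comm D₁.1,
    hD₁.pairing_eq hC₁ m₂, pairing_comm _ C₁.1, ← pairing_laxBracket hu C₁.2.1 C₂.2.1, ← e₁,
    pairing_laxBracket hu (mLoop_logVar γ X₁) C₂.2.1, ← e₂,
    ← pairing_laxBracket hu (mLoop_logVar γ X₁) (mLoop_logVar γ X₂), wTwo]

theorem exists_isHamiltonianAt (γ : Curve n) (X : Tangent γ) :
    ∃ F : loopsIn (VSpace n) → ℝ, IsHamiltonianAt F γ X := by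
  let v : ℝ → Matrix (Fin n) (Fin n) ℝ := fun x => Matrix.of fun i j =>
    if (i : ℕ) + 1 = n ∧ (j : ℕ) + 1 < n then logVar γ X x i j else 0
  have hv : v ∈ loopsIn (VtSpace n) := by
    refine ⟨fun i j => ?_, fun x i j h => by simp only [v, Matrix.of_apply, h, if_false]⟩
    by_cases h : (i : ℕ) + 1 = n ∧ (j : ℕ) + 1 < n
    · simp only [v, Matrix.of_apply, h, and_self, if_true]
      exact mLoop_logVar γ X i j
    · simp only [v, Matrix.of_apply, h, if_false]
      exact IsSmoothLoop.zero
  -- A linear functional has constant gradient `v`, and `v` is cut out of the last row of `g⁻¹ δ_X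
  -- g` so that the latter is `P_u(v)`.
  refine ⟨fun w => pairing v w.1, ⟨logVar γ X, mLoop_logVar γ X, trace_logVar γ X⟩,
    ⟨⟨v, hv⟩, fun w => ?_, ⟨fun x i j hi hj => ?_, laxBracket_logVar_mem γ X⟩⟩, dCurvature_eq γ X⟩
  · have h : ∀ s : ℝ, pairing v (curvature γ + s • w).1
        = pairing v (curvature γ).1 + s * pairing v w.1 := by
      intro s
      rw [pairing_comm, Submodule.coe_add, Submodule.coe_smul,
        pairing_add_left (curvature γ).2.1 ((loopsIn _).smul_mem s w.2).1 hv.1, pairing_smul_left,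
        pairing_comm v, pairing_comm v]
    simp only [h]
    simpa using ((hasDerivAt_id (0 : ℝ)).mul_const (pairing v w.1)).const_add
      (pairing v (curvature γ).1)
  · simp only [v, Matrix.of_apply, hi, hj, and_self, if_true]

/-! ### The kernel -/

/-- With `P = δ_X g · g⁻¹` the bracket is `g⁻¹ P_x g`, so it vanishes exactly when `P` is constant.
-/
theorem mem_orbitTangent_iff (hn : 0 < n) (γ : Curve n) (X : Tangent γ) :
    X ∈ orbitTangent γ ↔ ∀ x, laxBracket (curvature γ).1 (logVar γ X) x = 0 := by
  constructor
  · rintro ⟨c, _, hX⟩ x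
    have hX' : X.1 = fun x => c.mulVec (γ.toFun x) := funext hX
    have hd : deriv X.1 = fun x => c.mulVec (deriv γ.toFun x) := by
      funext y
      have := iteratedDeriv_mulVec c γ.smooth 1 y
      rwa [iteratedDeriv_one, iteratedDeriv_one, ← hX'] at this
    rw [laxBracket_logVar, logVar, hd, frame_mulVec c γ.smooth.deriv, frame_deriv_eq, hX',
      frame_mulVec c γ.smooth]
    noncomm_ring
  · intro h
    let P : ℝ → Matrix (Fin n) (Fin n) ℝ := frame X.1 * fun x => (frame γ.toFun x)⁻¹
    have hP : MSmooth P := (mLoop_frame X.2.1).smooth.mul γ.mLoop_inv.smooth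
    have hP' : mDeriv 1 P = 0 := by
      rw [mDeriv_mul (mLoop_frame X.2.1).smooth γ.mLoop_inv.smooth, mDeriv_frame X.2.1]
      funext x
      have h1 := h x
      rw [laxBracket_logVar, sub_eq_zero, logVar] at h1
      have h2 : frame (deriv X.1) x
          = frame X.1 x * (bMatrix n + curvMatrix γ.toFun x) := by
        have := congrArg (frame γ.toFun x * ·) h1
        simpa only [← mul_assoc, γ.mul_inv, one_mul] using this
      simp only [Pi.add_apply, Pi.mul_apply, mDeriv_inv_frame, h2, Pi.zero_apply]
      noncomm_ring
    have hc : ∀ x, P x = P 0 := fun x => Matrix.ext fun i j =>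
      is_const_of_deriv_eq_zero ((hP i j).differentiable (by simp))
        (fun y => congrFun (congrFun (congrFun hP' y) i) j) x 0
    have hfr : ∀ x, frame X.1 x = P 0 * frame γ.toFun x := fun x => by
      rw [← hc x]
      change _ = frame X.1 x * (frame γ.toFun x)⁻¹ * frame γ.toFun x
      rw [mul_assoc, γ.inv_mul, mul_one]
    refine ⟨P 0, ?_, fun x => funext fun i => ?_⟩
    · change (frame X.1 0 * (frame γ.toFun 0)⁻¹).trace = 0
      rw [Matrix.trace_mul_comm]
      exact trace_logVar γ X 0
    -- Column 0 of the frame is the curve itself.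
    · have := congrFun (congrFun (hfr x) i) ⟨0, hn⟩
      simpa [frame, Matrix.mul_apply, Matrix.mulVec, dotProduct] using this

theorem iteratedDeriv_apply_coord {X : ℝ → Fin n → ℝ} (hX : IsSmoothLoop X) (k : ℕ) (i : Fin n) :
    iteratedDeriv k (fun x => X x i) = fun x => iteratedDeriv k X x i := by
  induction k with
  | zero => simp
  | succ k ih =>
    funext x
    rw [iteratedDeriv_succ, iteratedDeriv_succ, ih]
    have h := ((hX.iteratedDeriv k).1.differentiable (by simp) x).hasDerivAt
    exact (hasDerivAt_pi.mp h i).deriv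

theorem isSmoothLoop_smul_iteratedDeriv (γ : Curve n) {f : ℝ → ℝ} (hf : IsSmoothLoop f) (k : ℕ) :
    IsSmoothLoop fun x => f x • iteratedDeriv k γ.toFun x :=
  ⟨hf.1.smul (γ.smooth.iteratedDeriv k).1, fun x => by
    simp only [hf.2 x, (γ.smooth.iteratedDeriv k).2 x]⟩

/-- The lower triangular part of `g⁻¹ δ_X g` for `X = f γ_x^{(k)}`. -/
theorem inv_mul_frame_smul (γ : Curve n) {f : ℝ → ℝ} (hf : IsSmoothLoop f) (k : ℕ) (x : ℝ)
    {i j : Fin n} (h : k + j ≤ i) :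
    ((frame γ.toFun x)⁻¹ * frame (fun x => f x • iteratedDeriv k γ.toFun x) x) i j
      = if (i : ℕ) = k + j then f x else 0 := by
  have hZ : iteratedDeriv j (fun x => f x • iteratedDeriv k γ.toFun x) x
      = ∑ l ∈ Finset.range ((j : ℕ) + 1), (((j : ℕ).choose l : ℝ) * iteratedDeriv l f x) •
        iteratedDeriv (k + (j - l)) γ.toFun x := by
    funext a
    have hk := γ.smooth.iteratedDeriv k
    rw [← congrFun (iteratedDeriv_apply_coord (isSmoothLoop_smul_iteratedDeriv γ hf k) j a) x]
    simp only [Pi.smul_apply, smul_eq_mul, Finset.sum_apply]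
    rw [iteratedDeriv_fun_mul (hf.1.contDiffAt.of_le (by exact_mod_cast le_top))
      ((isSmoothLoop_apply hk a).1.contDiffAt.of_le (by exact_mod_cast le_top))]
    refine Finset.sum_congr rfl fun l _ => ?_
    rw [iteratedDeriv_apply_coord hk]
    simp only [iteratedDeriv_eq_iterate, ← Function.iterate_add_apply]
    rw [add_comm k]
  have h1 : ((frame γ.toFun x)⁻¹ * frame (fun x => f x • iteratedDeriv k γ.toFun x) x) i j
      = ((frame γ.toFun x)⁻¹.mulVec
        (iteratedDeriv j (fun x => f x • iteratedDeriv k γ.toFun x) x)) i := rfl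
  have hi := i.2
  rw [h1, hZ, Matrix.mulVec_sum, Finset.sum_apply]
  -- Because `k + j ≤ i < n`, every derivative of `γ` in the Leibniz sum is a column of `g`, which
  -- `g⁻¹` sends to a basis vector; only `l = 0` can reach row `i`.
  have h2 : ∀ l ∈ Finset.range ((j : ℕ) + 1), ((frame γ.toFun x)⁻¹.mulVec
      ((((j : ℕ).choose l : ℝ) * iteratedDeriv l f x) • iteratedDeriv (k + (j - l)) γ.toFun x)) i
      = ((j : ℕ).choose l : ℝ) * iteratedDeriv l f x * if (i : ℕ) = k + (j - l) then 1 else 0 := by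
    intro l _
    rw [Matrix.mulVec_smul, Pi.smul_apply, smul_eq_mul]
    have := γ.inv_mulVec_iteratedDeriv x i ⟨k + (j - l), by omega⟩
    simp only [Fin.ext_iff] at this
    rw [this]
  rw [Finset.sum_congr rfl h2, Finset.sum_eq_single 0]
  · simp
  · intro l hl hl0
    have := Finset.mem_range.mp hl
    rw [if_neg (by omega), mul_zero]
  · simp

/-- A tangent vector whose `g⁻¹ δ_Y g` has the last row `(0, …, 0, f, *, …, *)`, the entry `f` being
at the place `m`. -/
theorem exists_tangent_lastRow (γ : Curve n) {f : ℝ → ℝ} (hf : IsSmoothLoop f) {l m : Fin n}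
    (hl : (l : ℕ) + 1 = n) (hm : (m : ℕ) < l) :
    ∃ Y : Tangent γ, (∀ x, logVar γ Y x l m = f x) ∧
      ∀ x, ∀ j : Fin n, j < m → logVar γ Y x l j = 0 := by
  -- The order `l - m` is chosen so that the leading term of column `m` is `f γ_x^{(l)}`, which lies
  -- in the last row.
  let Z : ℝ → Fin n → ℝ := fun x => f x • iteratedDeriv ((l : ℕ) - m) γ.toFun x
  have hZ : IsSmoothLoop Z := isSmoothLoop_smul_iteratedDeriv γ hf _
  -- Adding `c γ` puts `c` on the whole diagonal and zero below it: it adds `n c` to the trace and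
  -- leaves the last row unchanged before the corner.
  let c : ℝ → ℝ := fun x => (-(n : ℝ)⁻¹) * ((frame γ.toFun x)⁻¹ * frame Z x).trace
  have hKZ : MLoop fun x => (frame γ.toFun x)⁻¹ * frame Z x := γ.mLoop_inv.mul (mLoop_frame hZ)
  have hc : IsSmoothLoop c :=
    ⟨contDiff_const.mul hKZ.smooth.trace, fun x => by
      have := hKZ.periodic x
      simp only [c, this]⟩
  let T : ℝ → Fin n → ℝ := fun x => c x • iteratedDeriv 0 γ.toFun x
  have hT : IsSmoothLoop T := isSmoothLoop_smul_iteratedDeriv γ hc 0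
  have hsum : ∀ x, (frame γ.toFun x)⁻¹ * frame (Z + T) x
      = (frame γ.toFun x)⁻¹ * frame Z x + (frame γ.toFun x)⁻¹ * frame T x := fun x => by
    rw [frame_add hZ hT, mul_add]
  have hYt : Z + T ∈ Tangent γ := by
    refine ⟨hZ.add hT, fun x => ?_⟩
    rw [tangencyDefect, sum_det_updateCol (γ.det_frame x), hsum, Matrix.trace_add]
    have h1 : ((frame γ.toFun x)⁻¹ * frame T x).trace = n * c x := by
      rw [Matrix.trace, Finset.sum_congr rfl fun i _ => by
        rw [Matrix.diag_apply, inv_mul_frame_smul γ hc 0 x (by omega), if_pos (by omega)]]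
      simp
    rw [h1]
    have : (n : ℝ) ≠ 0 := by
      have := l.2
      exact_mod_cast (by omega : n ≠ 0)
    simp only [c]
    field_simp
    ring
  have hlog : ∀ x j, logVar γ ⟨Z + T, hYt⟩ x l j = ((frame γ.toFun x)⁻¹ * frame Z x) l j
      + ((frame γ.toFun x)⁻¹ * frame T x) l j := fun x j => congrFun (congrFun (hsum x) l) j
  refine ⟨⟨Z + T, hYt⟩, fun x => ?_, fun x j hj => ?_⟩
  · rw [hlog, inv_mul_frame_smul γ hf _ x (by omega), inv_mul_frame_smul γ hc 0 x (by omega),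
      if_pos (by omega), if_neg (by omega), add_zero]
  · have hj' : (j : ℕ) < m := hj
    rw [hlog, inv_mul_frame_smul γ hf _ x (by omega), inv_mul_frame_smul γ hc 0 x (by omega),
      if_neg (by omega), if_neg (by omega), add_zero]

theorem eq_zero_of_integral_mul_self {f : ℝ → ℝ} (hf : IsSmoothLoop f)
    (h : ∫ x in (0 : ℝ)..(2 * Real.pi), f x * f x = 0) : f = 0 := by
  funext x
  by_contra hx
  obtain ⟨y, hy, hxy⟩ := hf.2.exists_mem_Ico₀ Real.two_pi_pos x
  rw [hxy] at hx
  have := intervalIntegral.integral_pos Real.two_pi_pos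
    (hf.1.continuous.mul hf.1.continuous).continuousOn (fun z _ => mul_self_nonneg (f z))
    ⟨y, ⟨hy.1, hy.2.le⟩, mul_self_pos.mpr hx⟩
  exact this.ne' h

theorem laxBracket_eq_zero_of_wTwo (hn : 0 < n) (γ : Curve n) (X : Tangent γ)
    (h : ∀ Y, wTwo γ X Y = 0) (x : ℝ) : laxBracket (curvature γ).1 (logVar γ X) x = 0 := by
  set W := laxBracket (curvature γ).1 (logVar γ X) with hWdef
  have hW : W ∈ loopsIn (VSpace n) := laxBracket_logVar_mem γ X
  let l : Fin n := ⟨n - 1, by omega⟩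
  have hl : (l : ℕ) + 1 = n := Nat.sub_add_cancel hn
  -- Here `d` is the height of row `m` above the last row; the base case is the corner, which is
  -- zero in `V_n`.
  have key : ∀ d : ℕ, ∀ m : Fin n, (m : ℕ) + d = l → ∀ x, W x m l = 0 := by
    intro d
    induction d using Nat.strong_induction_on with
    | _ d ih =>
      intro m hm
      rcases Nat.eq_zero_or_pos d with rfl | hd
      · exact fun x => hW.2 x m l (by omega)
      -- Test with `f` equal to the entry itself. Rows above `m` are killed by the zeros of `Y`,
      -- rows below by induction, and `∮ f²` is left.
      obtain ⟨Y, hY, hY0⟩ := exists_tangent_lastRow γ (hW.1 m l) hl (m := m) (by omega)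
      have hint := h Y
      rw [wTwo, pairing] at hint
      have htr : ∀ x, (W x * logVar γ Y x).trace = W x m l * W x m l := by
        intro x
        rw [trace_mul_of_mem_VSpace (hW.2 x) hl, Finset.sum_eq_single m, hY]
        · intro j _ hj
          rcases lt_or_gt_of_ne hj with hj | hj
          · rw [hY0 x j hj, mul_zero]
          · have hj' : (m : ℕ) < j := hj
            rw [ih (l - j) (by omega) j (by omega), zero_mul]
        · simp
      rw [← hWdef] at hint
      simp only [htr] at hint
      exact congrFun (eq_zero_of_integral_mul_self (hW.1 m l) hint)
  ext i j
  by_cases hj : j = l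
  · subst hj
    exact key (l - i) i (by omega) x
  · have : (j : ℕ) ≠ l := fun h => hj (Fin.ext h)
    exact hW.2 x i j (by omega)

theorem wTwo_kernel_iff (hn : 0 < n) (γ : Curve n) (X : Tangent γ) :
    (∀ Y, wTwo γ X Y = 0) ↔ X ∈ orbitTangent γ := by
  rw [mem_orbitTangent_iff hn]
  refine ⟨laxBracket_eq_zero_of_wTwo hn γ X, fun h Y => ?_⟩
  simp [wTwo, pairing, h]

end TwoForm

/-! ### The Maurer–Cartan equation and the cyclic identity -/

section MaurerCartan

variable {E : Type} [NormedAddCommGroup E] [NormedSpace ℝ E] {n : ℕ}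
  {G H : E → Matrix (Fin n) (Fin n) ℝ}

/-- The Maurer–Cartan equation for the form `a ↦ g⁻¹ ∂_a g`. -/
theorem maurerCartan (hG : MSmooth G) (hH : MSmooth H) (h : H * G = 1) (a b : E) :
    mDeriv a (H * mDeriv b G) = mDeriv b (H * mDeriv a G)
      + (H * mDeriv b G * (H * mDeriv a G) - H * mDeriv a G * (H * mDeriv b G)) := by
  rw [mDeriv_mul hH (hG.mDeriv b), mDeriv_mul hH (hG.mDeriv a), mDeriv_leftInverse hG hH h,
    mDeriv_leftInverse hG hH h, mDeriv_comm hG a b]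
  noncomm_ring

/-- The pointwise algebra behind closedness. The letters stand for `A = M_e`, `a = M_v`, `b = M_w`,
`c = M_z`, `P = ∂_z M_v`, `Q = ∂_v M_w`, `R = ∂_w M_z`; a prime on any other letter than `A` is
`∂_e`, and `Av`, `Aw`, `Az` are derivatives of `A`. -/
theorem trace_cyclic_identity (A Av Aw Az a b c a' b' c' P Q R P' Q' R' :
      Matrix (Fin n) (Fin n) ℝ)
    (hAv : Av = a' + (A * a - a * A)) (hAw : Aw = b' + (A * b - b * A))
    (hAz : Az = c' + (A * c - c * A)) :
    ((P' + (Az * a + A * P - (P * A + a * Az))) * b).trace + (Av * (R + (b * c - c * b))).trace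
      + (((Q' + (Av * b + A * Q - (Q * A + b * Av))) * c).trace
        + (Aw * (P + (c * a - a * c))).trace)
      + (((R' + (Aw * c + A * R - (R * A + c * Aw))) * a).trace
        + (Az * (Q + (a * b - b * a))).trace)
    = (P' * b + P * b').trace + (Q' * c + Q * c').trace + (R' * a + R * a').trace
      + 2 * (a' * (b * c - c * b)
        + a * (b' * c + b * c' - (c' * b + c * b'))).trace := by
  have r1 : ∀ x X : Matrix (Fin n) (Fin n) ℝ, (x * X).trace = (X * x).trace :=
    fun x X => Matrix.trace_mul_comm x X
  have r2 : ∀ x X y : Matrix (Fin n) (Fin n) ℝ, (x * (X * y)).trace = (X * (y * x)).trace :=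
    fun x X y => by rw [r1, mul_assoc]
  have r3 : ∀ x y X : Matrix (Fin n) (Fin n) ℝ, (x * (y * X)).trace = (X * (x * y)).trace :=
    fun x y X => by rw [← mul_assoc, r1]
  have r4 : ∀ x y X z : Matrix (Fin n) (Fin n) ℝ,
      (x * (y * (X * z))).trace = (X * (z * (x * y))).trace :=
    fun x y X z => by rw [← mul_assoc, r2]
  subst hAv hAw hAz
  -- Each word contains at most one of `A`, `a'`, `b'`, `c'`. Rotating that letter to the front is a
  -- normal form under cyclicity of the trace.
  simp only [mul_add, add_mul, mul_sub, sub_mul, Matrix.trace_add, Matrix.trace_sub, mul_assoc,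
    r2 _ A, r4 _ _ A, r1 _ a', r2 _ a',
    r1 _ b', r2 _ b', r3 _ _ b', r1 _ c', r2 _ c', r3 _ _ c']
  ring

/-- The cyclic sum of the derivatives of `tr (∂_v (g⁻¹ ∂_e g) (g⁻¹ ∂_w g))` is a derivative in the
direction `e`. -/
theorem cyclic_sum_eq_dirDeriv (hG : MSmooth G) (hH : MSmooth H) (h : H * G = 1)
    (M : E → E → Matrix (Fin n) (Fin n) ℝ) (hM : ∀ a, M a = H * mDeriv a G) (e z v w p : E) :
    dirDeriv z (fun q => ((mDeriv v (M e) * M w) q).trace) p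
      + dirDeriv v (fun q => ((mDeriv w (M e) * M z) q).trace) p
      + dirDeriv w (fun q => ((mDeriv z (M e) * M v) q).trace) p
    = dirDeriv e (fun q => ((mDeriv z (M v) * M w) q).trace) p
      + dirDeriv e (fun q => ((mDeriv v (M w) * M z) q).trace) p
      + dirDeriv e (fun q => ((mDeriv w (M z) * M v) q).trace) p
      + 2 * dirDeriv e (fun q => ((M v * (M w * M z - M z * M w)) q).trace) p := by
  have hs : ∀ a, MSmooth (M a) := fun a => by rw [hM]; exact hH.mul (hG.mDeriv a)
  have mc : ∀ a b, mDeriv a (M b) = mDeriv b (M a) + (M b * M a - M a * M b) := fun a b => by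
    simp only [hM]; exact maurerCartan hG hH h a b
  have flat : ∀ a, mDeriv a (M e) = mDeriv e (M a) + (M e * M a - M a * M e) := fun a => mc a e
  -- The zero-curvature equation differentiated once more turns all second derivatives of `M e` into
  -- `e`-derivatives of first ones, up to commutators.
  have flat2 : ∀ a b, mDeriv a (mDeriv b (M e)) = mDeriv e (mDeriv a (M b))
      + (mDeriv a (M e) * M b + M e * mDeriv a (M b)
        - (mDeriv a (M b) * M e + M b * mDeriv a (M e))) := fun a b => by
    rw [flat b, mDeriv_add ((hs b).mDeriv e) (((hs e).mul (hs b)).sub ((hs b).mul (hs e))),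
      mDeriv_sub ((hs e).mul (hs b)) ((hs b).mul (hs e)), mDeriv_mul (hs e) (hs b),
      mDeriv_mul (hs b) (hs e), mDeriv_comm (hs b) a e]
  have lhs : ∀ a b c, dirDeriv a (fun q => ((mDeriv b (M e) * M c) q).trace) p
      = (mDeriv a (mDeriv b (M e)) p * M c p).trace
        + (mDeriv b (M e) p * mDeriv a (M c) p).trace := fun a b c => by
    rw [dirDeriv_trace (((hs e).mDeriv b).mul (hs c)), mDeriv_mul ((hs e).mDeriv b) (hs c)]
    exact Matrix.trace_add _ _
  have rhs : ∀ a b c, dirDeriv e (fun q => ((mDeriv a (M b) * M c) q).trace) p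
      = (mDeriv e (mDeriv a (M b)) p * M c p + mDeriv a (M b) p * mDeriv e (M c) p).trace :=
    fun a b c => by
    rw [dirDeriv_trace (((hs b).mDeriv a).mul (hs c)), mDeriv_mul ((hs b).mDeriv a) (hs c)]
    rfl
  have hwz := (hs w).mul (hs z)
  have hzw := (hs z).mul (hs w)
  -- The last three rewrites reduce the six mixed derivatives `∂_a M_b` to the three in cyclic
  -- order.
  rw [lhs, lhs, lhs, rhs, rhs, rhs, dirDeriv_trace ((hs v).mul (hwz.sub hzw)),
    mDeriv_mul (hs v) (hwz.sub hzw), mDeriv_sub hwz hzw, mDeriv_mul (hs w) (hs z),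
    mDeriv_mul (hs z) (hs w), flat2 z v, flat2 v w, flat2 w z, mc z w, mc v z, mc w v]
  exact trace_cyclic_identity (M e p) _ _ _ _ _ _ _ _ _ _ _ _ _ _ _
    (congrFun (flat v) p) (congrFun (flat w) p) (congrFun (flat z) p)

theorem mDeriv_periodic {A : E → Matrix (Fin n) (Fin n) ℝ} {T : E} (hA : Function.Periodic A T)
    (v : E) : Function.Periodic (mDeriv v A) T := fun p => by
  ext i j
  simp only [mDeriv, Matrix.of_apply, dirDeriv]
  rw [← fderiv_comp_add_right]
  simp only [hA _]

end MaurerCartan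

/-! ### Pull-back to smooth families: smoothness and closedness -/

section Families

variable {n k : ℕ}

/-- The moving frame of a smooth family of curves. -/
noncomputable def Family.frame (σ : Family n k) (p : EuclideanSpace ℝ (Fin k) × ℝ) :
    Matrix (Fin n) (Fin n) ℝ :=
  CentralAffine.frame (σ.toFun p.1).toFun p.2

/-- The form `a ↦ g⁻¹ ∂_a g` of a smooth family of curves. -/
noncomputable def Family.form (σ : Family n k) (a : EuclideanSpace ℝ (Fin k) × ℝ) :
    EuclideanSpace ℝ (Fin k) × ℝ → Matrix (Fin n) (Fin n) ℝ :=
  (fun p => (σ.frame p)⁻¹) * mDeriv a σ.frame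

theorem Family.frame_apply (σ : Family n k) (p : EuclideanSpace ℝ (Fin k) × ℝ) (i j : Fin n) :
    σ.frame p i j = (dirDeriv ((0 : EuclideanSpace ℝ (Fin k)), (1 : ℝ)))^[(j : ℕ)]
      (fun p => (σ.toFun p.1).toFun p.2) p i :=
  congrFun (iteratedDeriv_slice σ.smooth j p.1 p.2) i

theorem Family.mSmooth_frame (σ : Family n k) : MSmooth σ.frame := fun i j => by
  simp only [σ.frame_apply]
  exact contDiff_pi.mp (iterate_dirDeriv_contDiff _ σ.smooth j) i

theorem Family.mSmooth_inv (σ : Family n k) : MSmooth fun p => (σ.frame p)⁻¹ :=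
  σ.mSmooth_frame.inv fun p => (σ.toFun p.1).det_frame p.2

theorem Family.mSmooth_form (σ : Family n k) (a : EuclideanSpace ℝ (Fin k) × ℝ) :
    MSmooth (σ.form a) :=
  σ.mSmooth_inv.mul (σ.mSmooth_frame.mDeriv a)

theorem Family.inv_mul (σ : Family n k) : (fun p => (σ.frame p)⁻¹) * σ.frame = 1 :=
  funext fun p => (σ.toFun p.1).inv_mul p.2

theorem Family.periodic_frame (σ : Family n k) :
    Function.Periodic σ.frame ((0 : EuclideanSpace ℝ (Fin k)), 2 * Real.pi) := fun p => by
  simp only [Family.frame, Prod.fst_add, Prod.snd_add, add_zero]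
  exact (σ.toFun p.1).mLoop_frame.periodic p.2

theorem Family.periodic_form (σ : Family n k) (a : EuclideanSpace ℝ (Fin k) × ℝ) :
    Function.Periodic (σ.form a) ((0 : EuclideanSpace ℝ (Fin k)), 2 * Real.pi) := fun p => by
  simp only [Family.form, Pi.mul_apply, σ.periodic_frame p, mDeriv_periodic σ.periodic_frame a p]

theorem mDeriv_slice {A : EuclideanSpace ℝ (Fin k) × ℝ → Matrix (Fin n) (Fin n) ℝ}
    (hA : MSmooth A) (s : EuclideanSpace ℝ (Fin k)) (x : ℝ) :
    mDeriv (0, 1) A (s, x) = mDeriv 1 (fun y => A (s, y)) x := by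
  ext i j
  have := iteratedDeriv_slice (hA i j) 1 s x
  rw [iteratedDeriv_one] at this
  exact this.symm

theorem Family.mDeriv_frame (σ : Family n k) (s v : EuclideanSpace ℝ (Fin k)) (x : ℝ) :
    mDeriv (v, 0) σ.frame (s, x) = CentralAffine.frame (σ.velocity s v).1 x := by
  ext i j
  have hs := σ.smooth
  set f : EuclideanSpace ℝ (Fin k) × ℝ → Fin n → ℝ := fun p => (σ.toFun p.1).toFun p.2 with hf
  have hv : (σ.velocity s v).1 = fun x => dirDeriv (v, (0 : ℝ)) f (s, x) :=
    funext fun x => fderiv_slice hs s v x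
  simp only [mDeriv, Matrix.of_apply, CentralAffine.frame]
  rw [hv, iteratedDeriv_slice (dirDeriv_contDiff _ hs), iterate_dirDeriv_comm _ _ hs]
  have hD := (iterate_dirDeriv_contDiff ((0 : EuclideanSpace ℝ (Fin k)), (1 : ℝ)) hs
    j).differentiable (by simp) (s, x)
  have e : (fun q => σ.frame q i j) = fun q =>
      (dirDeriv ((0 : EuclideanSpace ℝ (Fin k)), (1 : ℝ)))^[(j : ℕ)] f q i :=
    funext fun q => σ.frame_apply q i j
  rw [e, dirDeriv, (hasFDerivAt_pi'.mp hD.hasFDerivAt i).fderiv]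
  rfl

theorem Family.form_velocity (σ : Family n k) (s v : EuclideanSpace ℝ (Fin k)) (x : ℝ) :
    σ.form (v, 0) (s, x) = logVar (σ.toFun s) (σ.velocity s v) x := by
  rw [Family.form, Pi.mul_apply, σ.mDeriv_frame]
  rfl

theorem Family.form_loop (σ : Family n k) (s : EuclideanSpace ℝ (Fin k)) (x : ℝ) :
    σ.form (0, 1) (s, x) = bMatrix n + curvMatrix (σ.toFun s).toFun x := by
  rw [Family.form, Pi.mul_apply, mDeriv_slice σ.mSmooth_frame, ← inv_mul_frame_deriv,
    ← CentralAffine.mDeriv_frame (σ.toFun s).smooth]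
  rfl

/-- By Maurer–Cartan in the directions `v` and `x`, the bracket is the derivative of `b + u` along
the family. The integrand is now a smooth function of parameter and `x`, ready for differentiation
under the integral. -/
theorem Family.wTwo_eq (σ : Family n k) (s v w : EuclideanSpace ℝ (Fin k)) :
    wTwo (σ.toFun s) (σ.velocity s v) (σ.velocity s w)
      = ∫ x in (0 : ℝ)..(2 * Real.pi),
          ((mDeriv (v, 0) (σ.form (0, 1)) * σ.form (w, 0)) (s, x)).trace := by
  rw [wTwo, pairing]
  refine congrArg (fun f : ℝ → ℝ => ∫ x in (0 : ℝ)..(2 * Real.pi), f x) (funext fun x => ?_)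
  have h := congrFun (maurerCartan σ.mSmooth_frame σ.mSmooth_inv σ.inv_mul (v, 0) (0, 1)) (s, x)
  change mDeriv (v, 0) (σ.form (0, 1)) (s, x) = mDeriv (0, 1) (σ.form (v, 0)) (s, x)
    + (σ.form (0, 1) (s, x) * σ.form (v, 0) (s, x)
      - σ.form (v, 0) (s, x) * σ.form (0, 1) (s, x)) at h
  rw [Pi.mul_apply, h, mDeriv_slice (σ.mSmooth_form _), σ.form_loop]
  simp only [σ.form_velocity]
  rfl

theorem Family.velocity_add (σ : Family n k) (s v w : EuclideanSpace ℝ (Fin k)) :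
    σ.velocity s (v + w) = σ.velocity s v + σ.velocity s w :=
  Subtype.ext (funext fun _ => map_add _ v w)

theorem Family.velocity_smul (σ : Family n k) (s : EuclideanSpace ℝ (Fin k)) (a : ℝ)
    (v : EuclideanSpace ℝ (Fin k)) : σ.velocity s (a • v) = a • σ.velocity s v :=
  Subtype.ext (funext fun _ => map_smul _ a v)

theorem Family.isSmoothClosed_wTwo (σ : Family n k) :
    IsSmoothClosed fun s v w => wTwo (σ.toFun s) (σ.velocity s v) (σ.velocity s w) := by
  have hφ : ∀ a b c, ContDiff ℝ ∞ fun q => ((mDeriv a (σ.form b) * σ.form c) q).trace :=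
    fun a b c => (((σ.mSmooth_form b).mDeriv a).mul (σ.mSmooth_form c)).trace
  refine isSmoothClosed_of_cyclic (fun s => ⟨fun X Y Z => ?_, fun a X Y => ?_, fun X Y => ?_⟩)
    (fun v w => ?_) fun s z v w => ?_
  · rw [σ.velocity_add, (wTwo_isSkewBilinear _).add_left]
  · rw [σ.velocity_smul, (wTwo_isSkewBilinear _).smul_left]
  · exact wTwo_skew _ _ _
  · simp only [σ.wTwo_eq]
    exact contDiff_intervalIntegral (hφ _ _ _) _ _
  · let Q : EuclideanSpace ℝ (Fin k) × ℝ → ℝ := fun q =>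
      ((mDeriv (z, 0) (σ.form (v, 0)) * σ.form (w, 0)) q).trace
        + ((mDeriv (v, 0) (σ.form (w, 0)) * σ.form (z, 0)) q).trace
        + ((mDeriv (w, 0) (σ.form (z, 0)) * σ.form (v, 0)) q).trace
        + 2 * ((σ.form (v, 0) * (σ.form (w, 0) * σ.form (z, 0)
          - σ.form (z, 0) * σ.form (w, 0))) q).trace
    have hψ : ContDiff ℝ ∞ fun q => ((σ.form (v, 0) * (σ.form (w, 0) * σ.form (z, 0)
          - σ.form (z, 0) * σ.form (w, 0))) q).trace :=
      ((σ.mSmooth_form _).mul (((σ.mSmooth_form _).mul (σ.mSmooth_form _)).sub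
        ((σ.mSmooth_form _).mul (σ.mSmooth_form _)))).trace
    have hQ : ContDiff ℝ ∞ Q :=
      (((hφ _ _ _).add (hφ _ _ _)).add (hφ _ _ _)).add (contDiff_const.mul hψ)
    have hint : ∀ {f : EuclideanSpace ℝ (Fin k) × ℝ → ℝ}, ContDiff ℝ ∞ f → ∀ a,
        IntervalIntegrable (fun x => dirDeriv a f (s, x)) MeasureTheory.volume 0 (2 * Real.pi) :=
      fun hf a => ((dirDeriv_contDiff a hf).continuous.comp
        (by fun_prop : Continuous fun x : ℝ => (s, x))).intervalIntegrable _ _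
    simp only [σ.wTwo_eq]
    rw [fderiv_intervalIntegral_apply (hφ _ _ _), fderiv_intervalIntegral_apply (hφ _ _ _),
      fderiv_intervalIntegral_apply (hφ _ _ _),
      ← intervalIntegral.integral_add (hint (hφ _ _ _) _) (hint (hφ _ _ _) _),
      ← intervalIntegral.integral_add ((hint (hφ _ _ _) _).add (hint (hφ _ _ _) _))
        (hint (hφ _ _ _) _)]
    have hd : ∀ x : ℝ, deriv (fun y => Q (s, y)) x = dirDeriv (0, 1) Q (s, x) := fun x => by
      have := iteratedDeriv_slice hQ 1 s x
      rwa [iteratedDeriv_one] at this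
    have hsum := fun x : ℝ => (cyclic_sum_eq_dirDeriv σ.mSmooth_frame σ.mSmooth_inv σ.inv_mul
      σ.form (fun _ => rfl) (0, 1) (z, 0) (v, 0) (w, 0) (s, x)).trans (b := _)
        (c := deriv (fun y => Q (s, y)) x) (by
          rw [hd]
          simp only [Q]
          rw [dirDeriv_fun_add (((hφ _ _ _).add (hφ _ _ _)).add (hφ _ _ _))
            (contDiff_const.mul hψ), dirDeriv_fun_add ((hφ _ _ _).add (hφ _ _ _)) (hφ _ _ _),
            dirDeriv_fun_add (hφ _ _ _) (hφ _ _ _), dirDeriv_fun_mul contDiff_const hψ]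
          simp [dirDeriv])
    rw [intervalIntegral.integral_congr fun x _ => hsum x]
    have hQs : ContDiff ℝ ∞ fun y => Q (s, y) := hQ.comp (contDiff_const.prodMk contDiff_id)
    rw [intervalIntegral.integral_deriv_eq_sub (fun x _ => hQs.differentiable (by simp) x)
      ((contDiff_infty_iff_deriv.mp hQs).2.continuous.intervalIntegrable _ _), sub_eq_zero]
    have hp : Q ((s, 0) + (0, 2 * Real.pi)) = Q (s, 0) := by
      simp only [Q, Pi.mul_apply, Pi.sub_apply, σ.periodic_form _ (s, 0),
        mDeriv_periodic (σ.periodic_form _) _ (s, 0)]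
    simpa using hp

theorem isClosedTwoForm_wTwo : IsClosedTwoForm (wTwo (n := n)) :=
  ⟨wTwo_isSkewBilinear, fun _ σ => σ.isSmoothClosed_wTwo⟩

end Families

/-! ### Descent to the orbit space -/

section Quotient

variable {n : ℕ}

theorem logVar_tangentMap (c : SLn n) {γ γ' : Curve n} (h : c • γ = γ') (X : Tangent γ) :
    logVar γ' (tangentMap c h X) = logVar γ X := by
  subst h
  funext x
  have hc : IsUnit c.1.det := by rw [c.2]; exact isUnit_one
  change (frame (c • γ).toFun x)⁻¹ * frame (fun x => c.1.mulVec (X.1 x)) x = _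
  rw [frame_smul_curve, frame_mulVec _ X.2.1, Matrix.mul_inv_rev, mul_assoc, ← mul_assoc c.1⁻¹,
    Matrix.nonsing_inv_mul _ hc, one_mul, logVar]

/-- The constant `c` cancels in `g⁻¹ g_x = b + u`. -/
theorem curvature_smul (c : SLn n) (γ : Curve n) : curvature (c • γ) = curvature γ := by
  refine Subtype.ext (funext fun x => ?_)
  have h1 := inv_mul_frame_deriv (c • γ) x
  have hc : IsUnit c.1.det := by rw [c.2]; exact isUnit_one
  have hd : frame (deriv (c • γ).toFun) x = c.1 * frame (deriv γ.toFun) x := by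
    rw [← mDeriv_frame (c • γ).smooth, funext (frame_smul_curve c γ), ← mDeriv_frame γ.smooth]
    have := mDeriv_mul (A := fun _ => c.1) (MLoop.const c.1).smooth γ.mLoop_frame.smooth (1 : ℝ)
    rw [mDeriv_const, zero_mul, zero_add] at this
    exact congrFun this x
  rw [frame_smul_curve, hd, Matrix.mul_inv_rev, mul_assoc, ← mul_assoc c.1⁻¹,
    Matrix.nonsing_inv_mul _ hc, one_mul, inv_mul_frame_deriv] at h1
  exact (add_left_cancel h1).symm

theorem wTwo_tangentMap (c : SLn n) {γ γ' : Curve n} (h : c • γ = γ') (X Y : Tangent γ) :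
    wTwo γ' (tangentMap c h X) (tangentMap c h Y) = wTwo γ X Y := by
  rw [wTwo, logVar_tangentMap, logVar_tangentMap, ← h, curvature_smul, wTwo]

theorem wTwo_congr (hn : 0 < n) {γ : Curve n} {X X' Y Y' : Tangent γ}
    (hX : (orbitTangent γ).mkQ X = (orbitTangent γ).mkQ X')
    (hY : (orbitTangent γ).mkQ Y = (orbitTangent γ).mkQ Y') : wTwo γ X Y = wTwo γ X' Y' := by
  have key : ∀ {X X' : Tangent γ}, (orbitTangent γ).mkQ X = (orbitTangent γ).mkQ X' →
      ∀ Y, wTwo γ X Y = wTwo γ X' Y := by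
    intro X X' h Y
    have h1 := (wTwo_kernel_iff hn γ (X - X')).mpr ((Submodule.Quotient.eq _).mp h) Y
    have h2 := (wTwo_isSkewBilinear γ).add_left (X - X') X' Y
    rw [sub_add_cancel, h1, zero_add] at h2
    exact h2
  rw [key hX, wTwo_skew, key hY, ← wTwo_skew]

/-- An equivariant field is determined by its value at `γ`, so any lift of that value will do. -/
theorem dProj_surjective (γ : Curve n) : Function.Surjective (dProj γ) := by
  intro ξ
  obtain ⟨X, hX⟩ := (orbitTangent γ).mkQ_surjective (ξ.1 ⟨γ, rfl⟩)
  refine ⟨X, Subtype.ext (funext fun γ' => ?_)⟩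
  change normalMap _ _ ((orbitTangent γ).mkQ X) = ξ.1 γ'
  rw [hX]
  exact (ξ.2 ⟨γ, rfl⟩ γ' _ (exists_smul_of_proj_eq γ'.2).choose_spec).symm

theorem dProj_add (γ : Curve n) (X Y : Tangent γ) : dProj γ (X + Y) = dProj γ X + dProj γ Y := by
  refine Subtype.ext (funext fun γ' => ?_)
  change normalMap _ _ ((orbitTangent γ).mkQ (X + Y)) = _
  rw [map_add, map_add]
  rfl

theorem dProj_smul (γ : Curve n) (a : ℝ) (X : Tangent γ) : dProj γ (a • X) = a • dProj γ X := by
  refine Subtype.ext (funext fun γ' => ?_)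
  change normalMap _ _ ((orbitTangent γ).mkQ (a • X)) = _
  rw [map_smul, map_smul]
  rfl

theorem dProj_eq_zero {γ : Curve n} {X : Tangent γ} (hX : X ∈ orbitTangent γ) :
    dProj γ X = 0 := by
  refine Subtype.ext (funext fun γ' => ?_)
  change normalMap _ _ ((orbitTangent γ).mkQ X) = 0
  rw [Submodule.mkQ_apply, (Submodule.Quotient.mk_eq_zero _).mpr hX, map_zero]

theorem exists_rep_eq (p : OrbitSpace n) : ∃ γ : Curve n, proj γ = p := Quotient.exists_rep p

/-- The form on the orbit space induced by `ŵ₂`, computed with representatives. -/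
noncomputable def inducedForm (p : OrbitSpace n) (ξ η : OrbitTangentSpace p) : ℝ :=
  wTwo (exists_rep_eq p).choose
    ((orbitTangent _).mkQ_surjective (ξ.1 ⟨_, (exists_rep_eq p).choose_spec⟩)).choose
    ((orbitTangent _).mkQ_surjective (η.1 ⟨_, (exists_rep_eq p).choose_spec⟩)).choose

theorem inducedForm_dProj (hn : 0 < n) (γ : Curve n) (X Y : Tangent γ) :
    inducedForm (proj γ) (dProj γ X) (dProj γ Y) = wTwo γ X Y := by
  have hp := (exists_rep_eq (proj γ)).choose_spec
  -- Transport by the `c` that carries `γ` to the chosen representative; there the transported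
  -- vectors and the chosen ones have equal classes modulo the orbit.
  rw [← wTwo_tangentMap _ (exists_smul_of_proj_eq hp).choose_spec X Y]
  exact wTwo_congr hn ((orbitTangent _).mkQ_surjective ((dProj γ X).1 ⟨_, hp⟩)).choose_spec
    ((orbitTangent _).mkQ_surjective ((dProj γ Y).1 ⟨_, hp⟩)).choose_spec

theorem inducedForm_isWeakSymplectic (hn : 0 < n) :
    IsWeakSymplecticOnOrbits (inducedForm (n := n)) where
  closed := by
    refine ⟨fun p => ?_, fun k σ => ?_⟩
    · obtain ⟨γ, rfl⟩ := exists_rep_eq p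
      have hs := dProj_surjective γ
      refine ⟨fun ξ η ζ => ?_, fun a ξ η => ?_, fun ξ η => ?_⟩
      · obtain ⟨X, rfl⟩ := hs ξ
        obtain ⟨Y, rfl⟩ := hs η
        obtain ⟨Z, rfl⟩ := hs ζ
        simp only [← dProj_add, inducedForm_dProj hn, (wTwo_isSkewBilinear γ).add_left]
      · obtain ⟨X, rfl⟩ := hs ξ
        obtain ⟨Y, rfl⟩ := hs η
        simp only [← dProj_smul, inducedForm_dProj hn, (wTwo_isSkewBilinear γ).smul_left]
      · obtain ⟨X, rfl⟩ := hs ξ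
        obtain ⟨Y, rfl⟩ := hs η
        rw [inducedForm_dProj hn, inducedForm_dProj hn, wTwo_skew]
    · simp only [inducedForm_dProj hn]
      exact σ.isSmoothClosed_wTwo
  nondegenerate p ξ h := by
    obtain ⟨γ, rfl⟩ := exists_rep_eq p
    obtain ⟨X, rfl⟩ := dProj_surjective γ ξ
    refine dProj_eq_zero ((wTwo_kernel_iff hn γ X).mp fun Y => ?_)
    rw [← inducedForm_dProj hn]
    exact h _

end Quotient

end CentralAffine

theorem mainTheorem11 (n : ℕ) (hn : 2 ≤ n) :
    -- `ŵ₂` is the 2-form defined by the pull-back of the second Poisson structure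
    (∀ (γ : Curve n) (F₁ F₂ : loopsIn (VSpace n) → ℝ) (X₁ X₂ : Tangent γ) (r : ℝ),
      IsHamiltonianAt F₁ γ X₁ → IsHamiltonianAt F₂ γ X₂ →
      IsPoissonBracket F₁ F₂ (curvature γ) r → wTwo γ X₁ X₂ = r) ∧
    (∀ (γ : Curve n) (X : Tangent γ), ∃ F : loopsIn (VSpace n) → ℝ, IsHamiltonianAt F γ X) ∧
    -- it is a closed 2-form on the space of curves
    IsClosedTwoForm (wTwo (n := n)) ∧
    -- its kernel is the tangent space of the orbit, which is the kernel of `dΨ`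
    (∀ (γ : Curve n) (X : Tangent γ),
      ((∀ Y : Tangent γ, wTwo γ X Y = 0) ↔ X ∈ orbitTangent γ) ∧
      (X ∈ orbitTangent γ ↔ ∀ x, dCurvature γ X x = 0)) ∧
    -- it descends to a unique form on the orbit space, which is weakly symplectic
    (∃ Ω : ∀ p : OrbitSpace n, OrbitTangentSpace p → OrbitTangentSpace p → ℝ,
      (∀ (γ : Curve n) (X Y : Tangent γ), Ω (proj γ) (dProj γ X) (dProj γ Y) = wTwo γ X Y) ∧
      IsWeakSymplecticOnOrbits Ω ∧
      ∀ Ω' : ∀ p : OrbitSpace n, OrbitTangentSpace p → OrbitTangentSpace p → ℝ,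
        (∀ (γ : Curve n) (X Y : Tangent γ), Ω' (proj γ) (dProj γ X) (dProj γ Y) = wTwo γ X Y) →
        Ω' = Ω) := by 
  have hn' : 0 < n := by omega
  refine ⟨fun γ F₁ F₂ X₁ X₂ r => wTwo_eq_of_isPoissonBracket, exists_isHamiltonianAt,
    isClosedTwoForm_wTwo, fun γ X => ⟨wTwo_kernel_iff hn' γ X, ?_⟩,
    inducedForm, inducedForm_dProj hn', inducedForm_isWeakSymplectic hn', fun Ω' h => ?_⟩
  · rw [mem_orbitTangent_iff hn', dCurvature_eq]
  -- Uniqueness: `q` and each `dq_γ` are surjective.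
  · funext p ξ η
    obtain ⟨γ, rfl⟩ := exists_rep_eq p
    obtain ⟨X, rfl⟩ := dProj_surjective γ ξ
    obtain ⟨Y, rfl⟩ := dProj_surjective γ η
    rw [h, inducedForm_dProj hn']
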